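/- Let $\mathcal{S}$ be a signature (a set of symbols $s$, each with an arity $|s| \in \mathbb{N}$) and let $K$ be a field. **Terms.** An $\mathcal{S}$-term is either the leaf or $s\, t_1 \cdots t_{|s|}$, where $s \in \mathcal{S}$ and the $t_i$ are $\mathcal{S}$-terms. Its internal nodes are numbered from $1$ in preorder; its degree is the number of its internal nodes; its decoration word lists the symbols of its internal nodes in this order. If the internal node $i$ is the $j$-th child of the internal node $p$ (by convention, $p = 1$ and $j = 0$ for the root $i = 1$), its connection value is $p + 1 - 2^{\,j - a}$, where $a$ is the arity of the symbol of $p$. The easterly wind order is: $t \preccurlyeq t'$ if $t$ and $t'$ have the same decoration word and the connection value of each node $i$ in $t$ is at most its connection value in $t'$. **Leaning forests.** An $\mathcal{S}$-forest $n\, t_1 \cdots t_n$ is a term on the signature $\mathcal{S} \sqcup \mathbb{N}$ (where $n \in \mathbb{N}$ has arity $n$) whose root is $n \in \mathbb{N}$ and where the $t_i$ are $\mathcal{S}$-terms. It is leaning if its degree is $n + 1$ and if, among $t_1, \dots, t_n$, all terms different from the leaf precede all leaves; $n$ is its size. Let $\mathfrak{L}$ be the set of leaning $\mathcal{S}$-forests,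 ordered by $\preccurlyeq$, and let $\mu$ be the Möbius function of this poset (in which all sets $\{f' : f \preccurlyeq f'\}$ are finite). Concatenation of forests is $n\, t_1 \cdots t_n \cdot n'\, t'_1 \cdots t'_{n'} = (n + n')\, t_1 \cdots t_n t'_1 \cdots t'_{n'}$. Let $f_1, f_2 \in \mathfrak{L}$. * "$f_1$ over $f_2$" is obtained from the concatenation of $f_1$ and $f_2$ by moving the children of the root which are leaves to the right of those which are not, without changing the order of the latter. * A leaf of a term is extreme if all internal nodes are visited before it in preorder. Let $n_2$ be the size of $f_2$, let $r$ be the number of extreme leaves of $f_1$, and for $m \in \mathbb{N}$ let $\mathfrak{c}(m)$ be the forest $m$ with $m$ leaves as children. "$f_1$ under $f_2$" is obtained by grafting, for each $j \in \{1, \dots, n_2 + r\}$, the $j$-th child subterm of the root of the concatenation of $f_2$ and $\mathfrak{c}(r)$ onto the $j$-th extreme leaf of the concatenation of $f_1$ and $\mathfrak{c}(n_2)$. **The algebra.** The natural Hopf algebra of the free nonsymmetric operad on $\mathcal{S}$ is, as an algebra, the $K$-linear span of the words on the $\mathcal{S}$-terms different from the leaf, with the product that extends the concatenation of words bilinearly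 (the coproduct plays no role in the statement). Its elementary basis is indexed by leaning forests: for $f \in \mathfrak{L}$, $E_f$ is the basis element given by the word formed by the children of the root of $f$ which are not leaves. The fundamental basis is defined, for $f \in \mathfrak{L}$, by $$F_f = \sum_{f' \in \mathfrak{L},\ f \preccurlyeq f'} \mu(f, f')\, E_{f'} .$$ **Theorem.** For all leaning $\mathcal{S}$-forests $f_1$ and $f_2$, $$F_{f_1} \cdot F_{f_2} = \sum_{\substack{f \in \mathfrak{L} \\ f_1 \text{ over } f_2 \,\preccurlyeq\, f \,\preccurlyeq\, f_1 \text{ under } f_2}} F_f .$$ -/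

import Mathlib

universe u v

/-- Terms on a signature, given as a type `S` of symbols with an arity map `ar`: a term is the
leaf, or a symbol `s` (an internal node) together with its `ar s` ordered children. -/
inductive Term {S : Type u} (ar : S → ℕ) : Type u
  | leaf : Term ar
  | node (s : S) (c : Fin (ar s) → Term ar) : Term ar

namespace Term

variable {S : Type u} {ar : S → ℕ}

/-- Whether a term is the leaf. -/
def isLeaf : Term ar → Bool
  | leaf => true
  | node _ _ => false

/-- The degree of a term: its number of internal nodes. -/
def deg : Term ar → ℕ
  | leaf => 0
  | node _ c => 1 + ∑ i, (c i).deg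

/-- The arity of a term: its number of leaves. -/
def arity : Term ar → ℕ
  | leaf => 1
  | node _ c => ∑ i, (c i).arity

/-- The decoration word: the decorations of the internal nodes in preorder. -/
def dc : Term ar → List S
  | leaf => []
  | node s c => s :: (List.finRange (ar s)).flatMap fun i => (c i).dc

/-- The preorder traversal: `none` for each visited leaf, `some s` for each visited internal node
decorated by `s`. -/
def traversal : Term ar → List (Option S)
  | leaf => [none]
  | node s c => some s :: (List.finRange (ar s)).flatMap fun i => (c i).traversal

/-- The number of extreme leaves, that is, of leaves visited after all the internal nodes. -/
def numExtreme (t : Term ar) : ℕ :=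
  (t.traversal.reverse.takeWhile Option.isNone).length

/-- The connection values, in preorder, of the internal nodes of a subterm whose root has number
`k` in the preorder numbering (starting with `1`) of the internal nodes of the whole term, and has
connection value `x`. A node with parent `p` and local position `j` (`1 ≤ j ≤` arity of `p`) has
connection value `p + 1 - 2 ^ (j - arity of p)`. The `i`-th child (with `i` starting with `0`), if
it is an internal node, is at local position `i + 1` and its number is `k + 1` plus the number of
internal nodes of the children on its left. -/
def cncFrom : Term ar → ℚ → ℕ → List ℚ
  | leaf, _, _ => []
  | node s c, x, k => x :: (List.finRange (ar s)).flatMap fun i =>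
      (c i).cncFrom ((k : ℚ) + 1 - 2 ^ (((i : ℕ) : ℤ) + 1 - (ar s : ℤ)))
        (k + 1 + ∑ j ∈ Finset.Iio i, (c j).deg)

/-- The connection word. By convention the root has number `1`, is its own parent, and has local
position `0`. -/
def cnc : Term ar → List ℚ
  | leaf => []
  | node s c => (node s c).cncFrom ((1 : ℚ) + 1 - 2 ^ ((0 : ℤ) - (ar s : ℤ))) 1

/-- The term obtained by substituting the leaves of a term, from left to right, with
`g 0`, `g 1`, … -/
def subst : Term ar → (ℕ → Term ar) → Term ar
  | leaf, g => g 0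
  | node s c, g => node s fun i =>
      (c i).subst fun m => g ((∑ j ∈ Finset.Iio i, (c j).arity) + m)

/-- The inclusion of the terms on the signature `S` in the terms on the disjoint union of `S` and
of the signature `ℕ`, where each `n : ℕ` has arity `n`. -/
def embed : Term ar → Term (Sum.elim ar (id : ℕ → ℕ))
  | leaf => leaf
  | node s c => node (Sum.inl s) fun i => (c i).embed

/-! The easterly wind relation is a partial order, with finite upper sets. -/

theorem cncFrom_eq_nil {t : Term ar} {x : ℚ} {k : ℕ} (h : t.cncFrom x k = []) : t = leaf := by
  cases t with
  | leaf => rfl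
  | node s c => simp [cncFrom] at h

theorem head_rest {s : S} (c : Fin (ar s) → Term ar) (k : ℕ) (o : Fin (ar s) → ℕ)
    (i : Fin (ar s)) (rest : List ℚ) (hr : ∀ e ∈ rest.head?, e < k)
    (L : List (Fin (ar s))) (hL : ∀ j ∈ L, i < j) :
    ∀ e ∈ (L.flatMap (fun j => (c j).cncFrom
        ((k : ℚ) + 1 - 2 ^ (((j : ℕ) : ℤ) + 1 - (ar s : ℤ))) (o j)) ++ rest).head?,
      e < (k : ℚ) + 1 ∧ e ≠ (k : ℚ) + 1 - 2 ^ (((i : ℕ) : ℤ) + 1 - (ar s : ℤ)) := by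
  induction L with
  | nil =>
    intro e he
    have h1 := hr e (by simpa using he)
    refine ⟨by linarith, ?_⟩
    have : (2 : ℚ) ^ (((i : ℕ) : ℤ) + 1 - (ar s : ℤ)) ≤ 1 :=
      zpow_le_one_of_nonpos₀ (by norm_num) (by have := i.2; omega)
    intro h
    linarith
  | cons j L ih =>
    intro e he
    cases hc : c j with
    | leaf =>
      apply ih (fun j' hj' => hL j' (by simp [hj']))
      simpa [hc, cncFrom] using he
    | node s' c' =>
      have he' : e = (k : ℚ) + 1 - 2 ^ (((j : ℕ) : ℤ) + 1 - (ar s : ℤ)) := by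
        simpa [hc, cncFrom, eq_comm] using he
      subst he'
      have hpos : (0 : ℚ) < 2 ^ (((j : ℕ) : ℤ) + 1 - (ar s : ℤ)) := by positivity
      refine ⟨by linarith, ?_⟩
      intro h
      have h2 : (2 : ℚ) ^ (((j : ℕ) : ℤ) + 1 - (ar s : ℤ)) =
          2 ^ (((i : ℕ) : ℤ) + 1 - (ar s : ℤ)) := by linarith
      have h3 := zpow_right_injective₀ (by norm_num : (0 : ℚ) < 2) (by norm_num) h2
      have h4 : (i : ℕ) < (j : ℕ) := hL j (by simp)
      omega

theorem cncFrom_injective (t : Term ar) : ∀ (t' : Term ar) (x : ℚ) (k : ℕ)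
    (rest rest' : List ℚ) (r r' : List S),
    (∀ e ∈ rest.head?, e < k ∧ e ≠ x) → (∀ e ∈ rest'.head?, e < k ∧ e ≠ x) →
    t.cncFrom x k ++ rest = t'.cncFrom x k ++ rest' → t.dc ++ r = t'.dc ++ r' → t = t' := by
  induction t with
  | leaf =>
    intro t' x k rest rest' r r' h1 h2 h h'
    cases t' with
    | leaf => rfl
    | node s' c' =>
      simp only [cncFrom, List.nil_append] at h
      exact absurd rfl (h1 x (by simp [h])).2
  | node s c ih =>
    intro t' x k rest rest' r r' h1 h2 h h'
    cases t' with
    | leaf =>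
      simp only [cncFrom, List.nil_append] at h
      exact absurd rfl (h2 x (by simp [← h])).2
    | node s' c' =>
      simp only [dc, List.cons_append, List.cons.injEq] at h'
      obtain ⟨rfl, h'⟩ := h'
      simp only [cncFrom, List.cons_append, List.cons.injEq, true_and] at h
      congr 1
      funext i
      induction i using WellFoundedLT.induction with
      | ind i IH =>
        obtain ⟨L₁, L₂, hL⟩ : ∃ L₁ L₂, List.finRange (ar s) = L₁ ++ i :: L₂ :=
          List.append_of_mem (List.mem_finRange i)
        have hs : (List.finRange (ar s)).Pairwise (· < ·) := List.pairwise_lt_finRange _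
        rw [hL, List.pairwise_append] at hs
        have hL₁ : ∀ j ∈ L₁, j < i := fun j hj => hs.2.2 j hj i (by simp)
        have hL₂ : ∀ j ∈ L₂, i < j := (List.pairwise_cons.1 hs.2.1).1
        have hoff : ∀ j ≤ i, ∑ l ∈ Finset.Iio j, (c' l).deg = ∑ l ∈ Finset.Iio j, (c l).deg :=
          fun j hj => Finset.sum_congr rfl fun l hl => by
            rw [IH l (lt_of_lt_of_le (Finset.mem_Iio.1 hl) hj)]
        rw [hL] at h h'
        simp only [List.flatMap_append, List.flatMap_cons, List.append_assoc] at h h'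
        have e1 : (L₁.flatMap fun j => (c' j).dc) = L₁.flatMap fun j => (c j).dc :=
          List.flatMap_congr fun j hj => by rw [IH j (hL₁ j hj)]
        have e2 : (L₁.flatMap fun j => (c' j).cncFrom
              ((k : ℚ) + 1 - 2 ^ (((j : ℕ) : ℤ) + 1 - (ar s : ℤ)))
              (k + 1 + ∑ l ∈ Finset.Iio j, (c' l).deg)) =
            L₁.flatMap fun j => (c j).cncFrom
              ((k : ℚ) + 1 - 2 ^ (((j : ℕ) : ℤ) + 1 - (ar s : ℤ)))
              (k + 1 + ∑ l ∈ Finset.Iio j, (c l).deg) :=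
          List.flatMap_congr fun j hj => by rw [IH j (hL₁ j hj), hoff j (hL₁ j hj).le]
        rw [e1] at h'
        rw [e2, hoff i le_rfl] at h
        have h := List.append_cancel_left h
        have h' := List.append_cancel_left h'
        refine ih i (c' i) _ _ _ _ _ _ ?_ ?_ h h'
        · intro e he
          have := head_rest c k _ i rest (fun e he => (h1 e he).1) L₂ hL₂ e he
          refine ⟨?_, this.2⟩
          push_cast
          have h3 : (0 : ℚ) ≤ ∑ l ∈ Finset.Iio i, ((c l).deg : ℚ) :=
            Finset.sum_nonneg fun _ _ => Nat.cast_nonneg _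
          linarith [this.1]
        · intro e he
          have := head_rest c' k _ i rest' (fun e he => (h2 e he).1) L₂ hL₂ e he
          refine ⟨?_, this.2⟩
          push_cast
          have h3 : (0 : ℚ) ≤ ∑ l ∈ Finset.Iio i, ((c l).deg : ℚ) :=
            Finset.sum_nonneg fun _ _ => Nat.cast_nonneg _
          linarith [this.1]

theorem eq_of_dc_cnc {t t' : Term ar} (h : t.dc = t'.dc) (h' : t.cnc = t'.cnc) : t = t' := by
  cases t with
  | leaf =>
    cases t' with
    | leaf => rfl
    | node s c => simp [dc] at h
  | node s c =>
    cases t' with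
    | leaf => simp [dc] at h
    | node s' c' =>
      have hs : s = s' := by simp only [dc, List.cons.injEq] at h; exact h.1
      subst hs
      refine cncFrom_injective _ _ _ _ [] [] [] [] (by simp) (by simp)
        (congrArg (· ++ []) h') (congrArg (· ++ []) h)

theorem forall₂_trans {l₁ l₂ : List ℚ} (h : List.Forall₂ (· ≤ ·) l₁ l₂) :
    ∀ {l₃ : List ℚ}, List.Forall₂ (· ≤ ·) l₂ l₃ → List.Forall₂ (· ≤ ·) l₁ l₃ := by
  induction h with
  | nil => intro l₃ h'; exact h'
  | cons hab _ ih =>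
    intro l₃ h'
    cases h' with
    | cons hbc h' => exact List.Forall₂.cons (hab.trans hbc) (ih h')

theorem forall₂_antisymm {l₁ l₂ : List ℚ} (h : List.Forall₂ (· ≤ ·) l₁ l₂) :
    List.Forall₂ (· ≤ ·) l₂ l₁ → l₁ = l₂ := by
  induction h with
  | nil => intro _; rfl
  | cons hab _ ih =>
    intro h'
    cases h' with
    | cons hba h' => rw [le_antisymm hab hba, ih h']

/-- The easterly wind order on terms: equality of the decoration words and letterwise comparison
of the connection words. -/
instance : PartialOrder (Term ar) where
  le t₁ t₂ := t₁.dc = t₂.dc ∧ List.Forall₂ (· ≤ ·) t₁.cnc t₂.cnc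
  le_refl t := ⟨rfl, List.forall₂_refl _⟩
  le_trans _ _ _ h₁ h₂ := ⟨h₁.1.trans h₂.1, forall₂_trans h₁.2 h₂.2⟩
  le_antisymm _ _ h₁ h₂ := eq_of_dc_cnc h₁.1 (forall₂_antisymm h₁.2 h₂.2)

theorem length_dc (t : Term ar) : t.dc.length = t.deg := by
  induction t with
  | leaf => rfl
  | node s c ih =>
    simp only [dc, deg, List.length_cons, List.length_flatMap, ih]
    rw [add_comm, Fin.sum_univ_def]

theorem finite_dc_subset (D : Set S) (hD : D.Finite) (n : ℕ) :
    {t : Term ar | t.deg ≤ n ∧ ∀ s ∈ t.dc, s ∈ D}.Finite := by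
  induction n with
  | zero =>
    refine (Set.finite_singleton leaf).subset ?_
    rintro (_ | ⟨s, c⟩) ⟨h, -⟩
    · rfl
    · simp [deg] at h
  | succ n ih =>
    refine ((Set.finite_singleton leaf).union (hD.biUnion fun s _ =>
      (Set.Finite.pi' (fun _ : Fin (ar s) => ih)).image (node s))).subset ?_
    rintro (_ | ⟨s, c⟩) ⟨h, h'⟩
    · exact Or.inl rfl
    · refine Or.inr (Set.mem_biUnion (h' s (by simp [dc])) ⟨c, fun i => ⟨?_, ?_⟩, rfl⟩)
      · have := Finset.single_le_sum (f := fun i => (c i).deg) (fun _ _ => Nat.zero_le _)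
          (Finset.mem_univ i)
        simp only [deg] at h
        omega
      · intro s' hs'
        exact h' s' (by
          simp only [dc, List.mem_cons, List.mem_flatMap]
          exact Or.inr ⟨i, List.mem_finRange i, hs'⟩)

theorem finite_Ici (t : Term ar) : (Set.Ici t).Finite := by
  refine (finite_dc_subset {s | s ∈ t.dc} (List.finite_toSet _) t.deg).subset ?_
  intro t' (h : t ≤ t')
  refine ⟨?_, fun s hs => ?_⟩
  · rw [← length_dc, ← length_dc, h.1]
  · simpa [h.1] using hs

theorem sum_blocks {n : ℕ} (a : Fin n → ℕ) (G : ℕ → ℕ) :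
    ∑ i, ∑ m ∈ Finset.range (a i), G ((∑ j ∈ Finset.Iio i, a j) + m) =
      ∑ m ∈ Finset.range (∑ i, a i), G m := by
  induction n with
  | zero => simp
  | succ n ih =>
    rw [Fin.sum_univ_castSucc, Fin.sum_univ_castSucc, Finset.sum_range_add,
      ← ih (fun i => a i.castSucc)]
    congr 1
    · refine Finset.sum_congr rfl fun i _ => Finset.sum_congr rfl fun m _ => ?_
      congr 2
      rw [← Fin.map_castSuccEmb_Iio, Finset.sum_map]
      rfl
    · refine Finset.sum_congr rfl fun m _ => ?_
      congr 2
      rw [Fin.Iio_last_eq_map, Finset.sum_map]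
      rfl

theorem embed_injective : Function.Injective (embed : Term ar → _) := by
  intro t
  induction t with
  | leaf => rintro (_ | ⟨s', c'⟩) h <;> simp [embed] at h ⊢
  | node s c ih =>
    rintro (_ | ⟨s', c'⟩) h
    · simp [embed] at h
    · simp only [embed, node.injEq, Sum.inl.injEq] at h
      obtain ⟨rfl, h⟩ := h
      congr 1
      funext i
      exact ih i (congrFun (eq_of_heq h) i)

theorem deg_embed (t : Term ar) : t.embed.deg = t.deg := by
  induction t with
  | leaf => rfl
  | node s c ih => exact congrArg (1 + ·) (Finset.sum_congr rfl fun i _ => ih i)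

theorem arity_embed (t : Term ar) : t.embed.arity = t.arity := by
  induction t with
  | leaf => rfl
  | node s c ih => exact Finset.sum_congr rfl fun i _ => ih i

theorem deg_subst (t : Term ar) (g : ℕ → Term ar) :
    (t.subst g).deg = t.deg + ∑ m ∈ Finset.range t.arity, (g m).deg := by
  induction t generalizing g with
  | leaf => simp [subst, deg, arity]
  | node s c ih =>
    simp only [subst, deg, arity, ih]
    rw [Finset.sum_add_distrib, sum_blocks (fun i => (c i).arity) fun m => (g m).deg]
    omega

theorem count_traversal (t : Term ar) : t.traversal.countP Option.isNone = t.arity := by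
  induction t with
  | leaf => rfl
  | node s c ih =>
    simp only [traversal, arity, List.countP_cons, List.countP_flatMap]
    rw [Fin.sum_univ_def]
    simp [Function.comp_def, ih]

theorem numExtreme_le_arity (t : Term ar) : t.numExtreme ≤ t.arity := by
  rw [← count_traversal, ← List.countP_reverse, numExtreme,
    ← List.countP_eq_length.2 fun x hx => List.mem_takeWhile_imp hx]
  exact (List.takeWhile_sublist _).countP_le

theorem le_numExtreme {t : Term ar} {X : List (Option S)} {k : ℕ}
    (h : t.traversal = X ++ List.replicate k none) : k ≤ t.numExtreme := by
  rw [numExtreme, h, List.reverse_append, List.reverse_replicate,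
    List.takeWhile_append_of_pos (by simp +contextual [List.mem_replicate])]
  simp

end Term

/-- Forests: a forest `n t₁ … tₙ` is made of its number `n` of children and of the terms
`t₁, …, tₙ`. -/
@[ext]
structure Forest {S : Type u} (ar : S → ℕ) : Type u where
  n : ℕ
  sub : Fin n → Term ar

namespace Forest

variable {S : Type u} {ar : S → ℕ}

/-- A forest `n t₁ … tₙ` seen as a term on the disjoint union of the signatures `S` and `ℕ`. -/
def toTerm (f : Forest ar) : Term (Sum.elim ar (id : ℕ → ℕ)) :=
  Term.node (Sum.inr f.n) fun i => (f.sub i).embed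

theorem toTerm_injective : Function.Injective (toTerm : Forest ar → _) := by
  rintro ⟨n, c⟩ ⟨n', c'⟩ h
  simp only [toTerm, Term.node.injEq, Sum.inr.injEq] at h
  obtain ⟨rfl, h⟩ := h
  congr 1
  funext i
  exact Term.embed_injective (congrFun (eq_of_heq h) i)

/-- A forest `n t₁ … tₙ` is balanced if its degree as a term is `n + 1`. -/
def IsBalanced (f : Forest ar) : Prop := f.toTerm.deg = f.n + 1

/-- The `{1}`-tilting map: the children of the root are rearranged so that the ones which are not
leaves keep their relative order and precede the ones which are leaves (`Tuple.sort` is the stable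
sorting permutation, and `false < true`). -/
def tilt (f : Forest ar) : Forest ar :=
  ⟨f.n, f.sub ∘ Tuple.sort fun i => (f.sub i).isLeaf⟩

/-- A forest is leaning if it is balanced and `{1}`-tilted. -/
def IsLeaning (f : Forest ar) : Prop := f.IsBalanced ∧ f.tilt = f

/-- The concatenation of two forests. -/
def concat (f₁ f₂ : Forest ar) : Forest ar := ⟨f₁.n + f₂.n, Fin.append f₁.sub f₂.sub⟩

/-- The substitution of the leaves of a forest, from left to right, with `g 0`, `g 1`, … -/
def subst (f : Forest ar) (g : ℕ → Term ar) : Forest ar :=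
  ⟨f.n, fun i => (f.sub i).subst fun m => g ((∑ j ∈ Finset.Iio i, (f.sub j).arity) + m)⟩

/-- The corolla with `n` leaves, as a forest. -/
def corolla (n : ℕ) : Forest ar := ⟨n, fun _ => Term.leaf⟩

/-- The grafting of the subterms of the root of `h`, from left to right, onto the extreme leaves
of `f`, from left to right; the other leaves of `f` are not changed. -/
def graftExtreme (f h : Forest ar) : Forest ar :=
  f.subst fun m =>
    if f.toTerm.arity - f.toTerm.numExtreme ≤ m then
      if hj : m - (f.toTerm.arity - f.toTerm.numExtreme) < h.n then h.sub ⟨_, hj⟩ else Term.leaf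
    else Term.leaf

theorem deg_toTerm (f : Forest ar) : f.toTerm.deg = 1 + ∑ i, (f.sub i).deg :=
  congrArg (1 + ·) (Finset.sum_congr rfl fun i _ => Term.deg_embed (f.sub i))

theorem arity_toTerm (f : Forest ar) : f.toTerm.arity = ∑ i, (f.sub i).arity :=
  Finset.sum_congr rfl fun i _ => Term.arity_embed (f.sub i)

theorem isBalanced_iff (f : Forest ar) : f.IsBalanced ↔ ∑ i, (f.sub i).deg = f.n := by
  rw [IsBalanced, deg_toTerm]
  omega

theorem tilt_eq_iff (f : Forest ar) : f.tilt = f ↔ Monotone fun i => (f.sub i).isLeaf := by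
  constructor
  · intro h
    have h1 := Tuple.monotone_sort fun i => (f.sub i).isLeaf
    have h2 : f.sub ∘ Tuple.sort (fun i => (f.sub i).isLeaf) = f.sub := by
      obtain ⟨n, c⟩ := f
      simpa [tilt] using h
    have h3 : (fun i => (f.sub i).isLeaf) ∘ Tuple.sort (fun i => (f.sub i).isLeaf) =
        fun i => (f.sub i).isLeaf := by
      funext i
      exact congrArg Term.isLeaf (congrFun h2 i)
    rwa [h3] at h1
  · intro h
    have h1 := Tuple.sort_eq_refl_iff_monotone.2 h
    simp [tilt, h1]

theorem isLeaning_tilt_concat (f₁ f₂ : Forest ar) (h₁ : f₁.IsBalanced) (h₂ : f₂.IsBalanced) :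
    (f₁.concat f₂).tilt.IsLeaning := by
  refine ⟨?_, ?_⟩
  · rw [isBalanced_iff] at *
    change ∑ i, ((f₁.concat f₂).sub (Tuple.sort _ i)).deg = f₁.n + f₂.n
    rw [Equiv.sum_comp _ fun i => ((f₁.concat f₂).sub i).deg]
    change ∑ i : Fin (f₁.n + f₂.n), (Fin.append f₁.sub f₂.sub i).deg = _
    rw [Fin.sum_univ_add]
    simp [h₁, h₂]
  · rw [tilt_eq_iff]
    exact Tuple.monotone_sort fun i => ((f₁.concat f₂).sub i).isLeaf

theorem deg_subst (f : Forest ar) (g : ℕ → Term ar) :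
    ∑ i, ((f.subst g).sub i).deg =
      ∑ i, (f.sub i).deg + ∑ m ∈ Finset.range f.toTerm.arity, (g m).deg := by
  change ∑ i : Fin f.n, ((f.sub i).subst _).deg = _
  simp only [Term.deg_subst]
  rw [Finset.sum_add_distrib, Term.sum_blocks _ fun m => (g m).deg, arity_toTerm]

theorem deg_graftExtreme (f h : Forest ar) (hle : h.n ≤ f.toTerm.numExtreme) :
    ∑ i, ((f.graftExtreme h).sub i).deg = ∑ i, (f.sub i).deg + ∑ i, (h.sub i).deg := by
  have hA := Term.numExtreme_le_arity f.toTerm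
  rw [graftExtreme, deg_subst]
  congr 1
  obtain ⟨B, hB⟩ : ∃ B, f.toTerm.arity = B + (h.n + (f.toTerm.numExtreme - h.n)) :=
    ⟨f.toTerm.arity - f.toTerm.numExtreme, by omega⟩
  have hB' : f.toTerm.arity - f.toTerm.numExtreme = B := by omega
  rw [hB']
  rw [hB, Finset.sum_range_add, Finset.sum_range_add, Finset.sum_eq_zero, Finset.sum_eq_zero
    (s := Finset.range (f.toTerm.numExtreme - h.n)), zero_add, add_zero, Finset.sum_range]
  · refine Finset.sum_congr rfl fun i _ => ?_
    simp
  · intro m _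
    simp [Term.deg]
  · intro m hm
    rw [if_neg (by simpa using hm)]
    rfl

theorem traversal_toTerm (f : Forest ar) : f.toTerm.traversal =
    some (Sum.inr f.n) :: (List.finRange f.n).flatMap fun i => (f.sub i).embed.traversal := rfl

theorem traversal_toTerm_concat_corolla (f : Forest ar) (n : ℕ) :
    (f.concat (corolla n)).toTerm.traversal =
      (some (Sum.inr (f.n + n)) ::
        (List.finRange f.n).flatMap fun i => (f.sub i).embed.traversal) ++
        List.replicate n none := by
  rw [traversal_toTerm]
  change some (Sum.inr (f.n + n)) :: (List.finRange (f.n + n)).flatMap (fun i =>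
    (Fin.append f.sub (fun _ => Term.leaf) i).embed.traversal) = _
  rw [List.cons_append]
  congr 1
  have h : (fun i => (Fin.append f.sub (fun _ : Fin n => Term.leaf) i).embed.traversal) =
      Fin.append (fun i => (f.sub i).embed.traversal) fun _ => [none] := by
    funext i
    refine Fin.addCases (fun i => ?_) (fun i => ?_) i
    · simp
    · simp [Term.embed, Term.traversal]
  rw [h, List.flatMap_def, ← List.ofFn_eq_map, List.ofFn_fin_append, List.flatten_append,
    List.ofFn_eq_map, List.flatMap_def, List.ofFn_const, List.flatten_replicate_singleton]

theorem numExtreme_concat_corolla (f : Forest ar) (n : ℕ) :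
    (f.concat (corolla n)).toTerm.numExtreme = n + f.toTerm.numExtreme := by
  rw [Term.numExtreme, traversal_toTerm_concat_corolla, List.reverse_append,
    List.reverse_replicate,
    List.takeWhile_append_of_pos (by simp +contextual [List.mem_replicate]), List.length_append,
    List.length_replicate]
  congr 1
  rw [Term.numExtreme, traversal_toTerm, List.reverse_cons, List.reverse_cons]
  generalize ((List.finRange f.n).flatMap fun i => (f.sub i).embed.traversal).reverse = l
  rw [List.takeWhile_append, List.takeWhile_append]
  split_ifs <;> simp

theorem isLeaning_graftExtreme (f h : Forest ar) (hle : h.n ≤ f.toTerm.numExtreme)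
    (hf : f.tilt = f) (hh : h.tilt = h)
    (hd : ∑ i, (f.sub i).deg + ∑ i, (h.sub i).deg = f.n) :
    (f.graftExtreme h).IsLeaning := by
  refine ⟨?_, ?_⟩
  · rw [isBalanced_iff, deg_graftExtreme f h hle, hd]
    rfl
  · rw [tilt_eq_iff] at *
    intro (i : Fin f.n) (j : Fin f.n) hij
    rcases hij.eq_or_lt with rfl | hij
    · exact le_rfl
    rw [Bool.le_iff_imp]
    intro hi
    have hsub : ∀ i : Fin f.n, ((f.graftExtreme h).sub i).isLeaf = true →
        (f.sub i) = Term.leaf := by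
      intro i hi
      cases hc : f.sub i with
      | leaf => rfl
      | node s c => simp [graftExtreme, subst, hc, Term.subst, Term.isLeaf] at hi
    have hleaf : ∀ l, i ≤ l → f.sub l = Term.leaf := by
      intro l hl
      have h1 := hf hl
      change (f.sub i).isLeaf ≤ (f.sub l).isLeaf at h1
      rw [hsub i hi] at h1
      cases hc : f.sub l with
      | leaf => rfl
      | node s c => exact absurd h1 (by rw [hc]; exact (by decide : ¬(true ≤ false)))
    set a : Fin f.n → ℕ := fun i => ∑ l ∈ Finset.Iio i, (f.sub l).arity with ha
    have haij : a i ≤ a j := Finset.sum_le_sum_of_subset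
      (Finset.Iio_subset_Iio hij.le)
    have hai : f.toTerm.arity - f.toTerm.numExtreme ≤ a i := by
      have h1 : f.n - i ≤ f.toTerm.numExtreme := by
        refine Term.le_numExtreme (X := some (Sum.inr f.n) :: ((List.finRange f.n).take i).flatMap
          fun l => (f.sub l).embed.traversal) ?_
        rw [traversal_toTerm, List.cons_append]
        congr 1
        conv_lhs => rw [← List.take_append_drop i (List.finRange f.n)]
        rw [List.flatMap_append]
        congr 1
        have h2 : ((List.finRange f.n).drop i).flatMap (fun l => (f.sub l).embed.traversal) =
            ((List.finRange f.n).drop i).flatMap (fun _ => [none]) := by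
          refine List.flatMap_congr fun l hl => ?_
          rw [hleaf l]
          · rfl
          · obtain ⟨m, hm, rfl⟩ := List.mem_iff_getElem.1 hl
            simp [Fin.le_def]
        rw [h2]
        simp [List.flatMap_def, List.flatten_replicate_singleton, List.map_const']
      have h3 : f.toTerm.arity = a i + (f.n - i) := by
        rw [arity_toTerm, ← Finset.sum_add_sum_compl (Finset.Iio i)]
        congr 1
        rw [Finset.sum_congr rfl (g := fun _ => 1)]
        · simp [Finset.card_compl]
        · intro l hl
          rw [hleaf l (by simpa using hl)]
          rfl
      omega
    have hval : ∀ l, f.sub l = Term.leaf → (f.graftExtreme h).sub l =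
        if f.toTerm.arity - f.toTerm.numExtreme ≤ a l then
          if hj : a l - (f.toTerm.arity - f.toTerm.numExtreme) < h.n then h.sub ⟨_, hj⟩
          else Term.leaf
        else Term.leaf := by
      intro l hl
      change (f.sub l).subst _ = _
      rw [hl]
      rfl
    change ((f.graftExtreme h).sub i).isLeaf = true at hi
    rw [hval i (hleaf i le_rfl), if_pos hai] at hi
    change ((f.graftExtreme h).sub j).isLeaf = true
    rw [hval j (hleaf j hij.le), if_pos (hai.trans haij)]
    split_ifs with hj
    · rw [dif_pos (by omega)] at hi
      have h4 := hh (a := ⟨a i - (f.toTerm.arity - f.toTerm.numExtreme), by omega⟩)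
        (b := ⟨a j - (f.toTerm.arity - f.toTerm.numExtreme), hj⟩)
        (by rw [Fin.mk_le_mk]; omega)
      exact Bool.le_iff_imp.1 h4 hi
    · rfl

theorem tilt_concat_corolla {f : Forest ar} (hf : f.tilt = f) (n : ℕ) :
    (f.concat (corolla n)).tilt = f.concat (corolla n) := by
  rw [tilt_eq_iff] at *
  intro (i : Fin (f.n + n)) (j : Fin (f.n + n)) hij
  change (Fin.append f.sub (fun _ => Term.leaf) i).isLeaf ≤
    (Fin.append f.sub (fun _ => Term.leaf) j).isLeaf
  induction j using Fin.addCases with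
  | right j =>
    rw [Fin.append_right]
    exact Bool.le_true _
  | left j =>
    induction i using Fin.addCases with
    | right i =>
      have h1 := j.2
      have h2 : f.n + (i : ℕ) ≤ (j : ℕ) := hij
      omega
    | left i =>
      rw [Fin.append_left, Fin.append_left]
      exact hf (Fin.le_def.2 (show (i : ℕ) ≤ (j : ℕ) from hij))

theorem sum_deg_concat_corolla (f : Forest ar) (n : ℕ) :
    ∑ i, ((f.concat (corolla n)).sub i).deg = ∑ i, (f.sub i).deg := by
  change ∑ i : Fin (f.n + n), (Fin.append f.sub (fun _ => Term.leaf) i).deg = _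
  rw [Fin.sum_univ_add]
  simp [Term.deg]

end Forest

/-- The type of leaning forests. -/
def LeaningForest {S : Type u} (ar : S → ℕ) : Type u := {f : Forest ar // f.IsLeaning}

namespace LeaningForest

variable {S : Type u} {ar : S → ℕ}

theorem toTerm_injective : Function.Injective fun f : LeaningForest ar => f.1.toTerm :=
  Forest.toTerm_injective.comp Subtype.val_injective

/-- The easterly wind order on leaning forests, seen as terms. -/
instance : PartialOrder (LeaningForest ar) :=
  PartialOrder.lift (fun f => f.1.toTerm) toTerm_injective

theorem finite_Ici (f : LeaningForest ar) : (Set.Ici f).Finite :=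
  Set.Finite.preimage toTerm_injective.injOn (Term.finite_Ici f.1.toTerm)

noncomputable instance : LocallyFiniteOrder (LeaningForest ar) :=
  LocallyFiniteOrder.ofFiniteIcc fun f _ => (finite_Ici f).subset fun _ h => h.1

open scoped Classical in
noncomputable instance : LocallyFiniteOrderTop (LeaningForest ar) :=
  LocallyFiniteOrderTop.ofIci _ (fun f => (finite_Ici f).toFinset) fun f f' => by simp

/-- The over operation: the `{1}`-tilting of the concatenation. -/
def overOp (f₁ f₂ : LeaningForest ar) : LeaningForest ar :=
  ⟨(f₁.1.concat f₂.1).tilt, Forest.isLeaning_tilt_concat _ _ f₁.2.1 f₂.2.1⟩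

/-- The under operation: with `n₂` the size of `f₂` and `r` the number of extreme leaves of `f₁`,
the subterms of the root of the concatenation of `f₂` and of the corolla with `r` leaves are
grafted, from left to right, onto the extreme leaves of the concatenation of `f₁` and of the
corolla with `n₂` leaves. -/
def underOp (f₁ f₂ : LeaningForest ar) : LeaningForest ar :=
  ⟨(f₁.1.concat (Forest.corolla f₂.1.n)).graftExtreme
      (f₂.1.concat (Forest.corolla f₁.1.toTerm.numExtreme)),
    Forest.isLeaning_graftExtreme _ _ (Forest.numExtreme_concat_corolla _ _).ge
      (Forest.tilt_concat_corolla f₁.2.2 _) (Forest.tilt_concat_corolla f₂.2.2 _) (by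
        rw [Forest.sum_deg_concat_corolla, Forest.sum_deg_concat_corolla,
          (Forest.isBalanced_iff _).1 f₁.2.1, (Forest.isBalanced_iff _).1 f₂.2.1]
        rfl)⟩

/-- The reduced word identified with a leaning forest: the word of the subterms of its root which
are different from the leaf (the unit of the free operad). -/
def word (f : LeaningForest ar) : FreeMonoid {t : Term ar // t.isLeaf = false} :=
  FreeMonoid.ofList ((List.ofFn f.1.sub).filterMap fun t =>
    if h : t.isLeaf = false then some ⟨t, h⟩ else none)

end LeaningForest

/-- The natural Hopf algebra of the free operad on the signature, as an algebra: the linear span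
of the reduced words on terms, that is, of the words on the terms different from the leaf, with
the product that extends the concatenation of words bilinearly. -/
abbrev NaturalAlgebra (K : Type v) [Field K] {S : Type u} (ar : S → ℕ) : Type (max u v) :=
  MonoidAlgebra K (FreeMonoid {t : Term ar // t.isLeaf = false})

namespace NaturalAlgebra

variable (K : Type v) [Field K] {S : Type u} {ar : S → ℕ}

/-- The elementary basis, indexed by leaning forests. -/
noncomputable def E (f : LeaningForest ar) : NaturalAlgebra K ar :=
  MonoidAlgebra.single f.word 1

open scoped Classical in
/-- The fundamental basis: `F f` is the sum of `μ(f, f') E f'` over all leaning forests `f' ≥ f`,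
where `μ` is the Möbius function of the easterly wind order on leaning forests. -/
noncomputable def F (f : LeaningForest ar) : NaturalAlgebra K ar :=
  ∑ f' ∈ Finset.Ici f, IncidenceAlgebra.mu K f f' • E K f'

end NaturalAlgebra

/-! The argument is Möbius inversion on both sides, joined by an adjunction. By Möbius inversion `E
f` is the sum of `F g` over `g ≥ f`, and `E f * E g = E (f.overOp g)`. Expanding the product of two
fundamental elements, the coefficient of `F f` is the sum of `μ(f₁, f₁') μ(f₂, f₂')` over the pairs
with `f₁' over f₂' ≤ f`. If `f` is not above `f₁ over f₂` there are no such pairs.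

Otherwise, cut `f` after its first `n₁` nodes other than the root, where `n₁` is the size of `f₁`.
The first part is a forest `g₁`. The second part becomes a forest `g₂` when the nodes whose parent
lies in the first part are attached to the root. Then `f₁' over f₂' ≤ f` is equivalent to `f₁' ≤ g₁`
and `f₂' ≤ g₂`, so the coefficient factors into two sums of Möbius values over the intervals from
`f₁` to `g₁` and from `f₂` to `g₂`. It is `1` if `f₁ = g₁` and `f₂ = g₂`, and `0` otherwise. This
condition is equivalent to `f ≤ f₁ under f₂`: the under operation gives the largest forest with
prescribed restrictions (`exists_overOp_le_iff`).

These facts are read off connection words. By `le_iff` the positions of the children of the root are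
irrelevant, so their connection values can all be set to `1`; over then becomes a shifted
concatenation of words. The function `scan` computes connection words from preorder traversals with
a stack of free positions. On traversals, under is a concatenation, after the trailing leaves of the
first forest are dropped. The stack is always decreasing, hence removing leaves, which moves later
terms to the left, can only increase connection values. -/

namespace Term

/-! ### Connection words computed from preorder traversals -/

variable {S : Type u} {ar : S → ℕ}

/-- The connection value of the child number `i` (starting with `0`) of the node number `k`,
decorated by `s`. -/
def childValue (ar : S → ℕ) (k : ℕ) (s : S) (i : ℕ) : ℚ :=
  (k : ℚ) + 1 - 2 ^ ((i : ℤ) + 1 - (ar s : ℤ))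

/-- The connection values of the free positions once the node number `k`, decorated by `s`, has
been put at the first free position. -/
def pushNode (ar : S → ℕ) (k : ℕ) (s : S) (σ : ℕ → ℚ) (i : ℕ) : ℚ :=
  if i < ar s then childValue ar k s i else σ (i - ar s + 1)

/-- The connection values of the internal nodes of a sequence of terms with a given preorder
traversal, where `σ` lists the connection values of the free positions from left to right and `k`
is the number of the first internal node. -/
def scan (ar : S → ℕ) : List (Option S) → (ℕ → ℚ) → ℕ → List ℚ
  | [], _, _ => []
  | none :: X, σ, k => scan ar X (fun i => σ (i + 1)) k
  | some s :: X, σ, k => σ 0 :: scan ar X (pushNode ar k s σ) (k + 1)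

theorem le_childValue (k : ℕ) (s : S) {i : ℕ} (hi : i < ar s) :
    (k : ℚ) ≤ childValue ar k s i := by
  have : (2 : ℚ) ^ ((i : ℤ) + 1 - (ar s : ℤ)) ≤ 1 :=
    zpow_le_one_of_nonpos₀ (by norm_num) (by omega)
  rw [childValue]
  linarith

theorem childValue_lt (k : ℕ) (s : S) (i : ℕ) : childValue ar k s i < (k : ℚ) + 1 := by
  have : (0 : ℚ) < 2 ^ ((i : ℤ) + 1 - (ar s : ℤ)) := by positivity
  rw [childValue]
  linarith

theorem childValue_antitone (k : ℕ) (s : S) : Antitone (childValue ar k s) := by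
  intro i j hij
  have : (2 : ℚ) ^ ((i : ℤ) + 1 - (ar s : ℤ)) ≤ 2 ^ ((j : ℤ) + 1 - (ar s : ℤ)) :=
    zpow_le_zpow_right₀ (by norm_num) (by omega)
  simp only [childValue]
  linarith

/-- The children of node `k` have values in `[k, k + 1)`, decreasing from left to right, and come
before the older free positions, whose values are less than `k`. This invariant is what makes the
order compatible with moves to the left. -/
theorem pushNode_antitone {k : ℕ} (s : S) {σ : ℕ → ℚ} (h : Antitone σ) (hk : ∀ i, σ i < k) :
    Antitone (pushNode ar k s σ) := by
  intro i j hij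
  simp only [pushNode]
  split_ifs with h1 h2 h2
  · exact childValue_antitone k s hij
  · omega
  · exact (hk _).le.trans (le_childValue k s h2)
  · exact h (by omega)

theorem pushNode_lt {k : ℕ} (s : S) {σ : ℕ → ℚ} (hk : ∀ i, σ i < k) (i : ℕ) :
    pushNode ar k s σ i < (k + 1 : ℕ) := by
  rw [pushNode]
  push_cast
  split_ifs
  · exact childValue_lt k s i
  · linarith [hk (i - ar s + 1)]

theorem sum_Iio_succ {n : ℕ} (a : Fin (n + 1) → ℕ) (i : Fin n) :
    ∑ j ∈ Finset.Iio i.succ, a j = a 0 + ∑ j ∈ Finset.Iio i, a j.succ := by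
  have h : Finset.Iio i.succ = insert 0 ((Finset.Iio i).map (Fin.succEmb n)) := by
    ext j
    refine Fin.cases ?_ (fun j => ?_) j
    · simp [Fin.succ_pos]
    · simp
  rw [h, Finset.sum_insert (by simp), Finset.sum_map]
  rfl

/-- The inductive step of `scan_traversal_append`, stated for an arbitrary family of terms so that
the number of children can vary in an induction. -/
theorem scan_flatMap_finRange {n : ℕ} (c : Fin n → Term ar)
    (ih : ∀ i (X : List (Option S)) (σ : ℕ → ℚ) (k : ℕ),
      scan ar ((c i).traversal ++ X) σ k =
        (c i).cncFrom (σ 0) k ++ scan ar X (fun i => σ (i + 1)) (k + (c i).deg))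
    (X : List (Option S)) (σ : ℕ → ℚ) (k : ℕ) :
    scan ar (((List.finRange n).flatMap fun i => (c i).traversal) ++ X) σ k =
      ((List.finRange n).flatMap fun i =>
        (c i).cncFrom (σ i) (k + ∑ j ∈ Finset.Iio i, (c j).deg)) ++
        scan ar X (fun i => σ (i + n)) (k + ∑ i, (c i).deg) := by
  induction n generalizing σ k with
  | zero => simp
  | succ n IH =>
    rw [List.finRange_succ, List.flatMap_cons, List.flatMap_cons, List.flatMap_map,
      List.flatMap_map, List.append_assoc, ih, IH (fun i => c i.succ) fun i => ih i.succ,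
      List.append_assoc]
    have h0 : Finset.Iio (0 : Fin (n + 1)) = ∅ := by
      ext j
      simp
    simp only [sum_Iio_succ, Fin.sum_univ_succ, ← add_assoc]
    rw [h0, Finset.sum_empty, add_zero]
    rfl

/-- A complete term consumes exactly one free position, since the positions created by its nodes are
all filled within it. This identifies `scan` with `cncFrom`. -/
theorem scan_traversal_append (t : Term ar) (X : List (Option S)) (σ : ℕ → ℚ) (k : ℕ) :
    scan ar (t.traversal ++ X) σ k =
      t.cncFrom (σ 0) k ++ scan ar X (fun i => σ (i + 1)) (k + t.deg) := by
  induction t generalizing X σ k with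
  | leaf => simp [traversal, scan, cncFrom, deg]
  | node s c ih =>
    rw [traversal, List.cons_append, scan, scan_flatMap_finRange c ih, cncFrom, deg,
      List.cons_append, add_assoc]
    congr 2
    · refine List.flatMap_congr fun i _ => ?_
      rw [pushNode, if_pos i.2, childValue]
    · congr 1
      funext i
      simp [pushNode]

theorem scan_flatMap_traversal_cons (t : Term ar) (L : List (Term ar)) (σ : ℕ → ℚ) (k : ℕ) :
    scan ar ((t :: L).flatMap traversal) σ k =
      t.cncFrom (σ 0) k ++ scan ar (L.flatMap traversal) (fun i => σ (i + 1)) (k + t.deg) := by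
  rw [List.flatMap_cons, scan_traversal_append]

/-- The word of the decorations of the internal nodes visited by a traversal. -/
theorem reduceOption_traversal (t : Term ar) : t.traversal.reduceOption = t.dc := by
  induction t with
  | leaf => rfl
  | node s c ih =>
    rw [traversal, List.reduceOption_cons_of_some, dc, List.reduceOption, List.filterMap_flatMap]
    exact congrArg _ (List.flatMap_congr fun i _ => ih i)

theorem reduceOption_flatMap_traversal (L : List (Term ar)) :
    (L.flatMap traversal).reduceOption = L.flatMap dc := by
  rw [List.reduceOption, List.filterMap_flatMap]
  exact List.flatMap_congr fun t _ => reduceOption_traversal t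

/-- Changing the values of the free positions and the number of the first internal node. -/
theorem map_scan (φ : ℚ → ℚ) (X : List (Option S)) (σ : ℕ → ℚ) (k l : ℕ)
    (h : ∀ j s i, i < ar s → φ (childValue ar (k + j) s i) = childValue ar (l + j) s i) :
    (scan ar X σ k).map φ = scan ar X (fun i => φ (σ i)) l := by
  induction X generalizing σ k l with
  | nil => rfl
  | cons a X ih =>
    cases a with
    | none => exact ih _ _ _ h
    | some s =>
      rw [scan, scan, List.map_cons, ih _ (k + 1) (l + 1)]
      · congr 2
        funext i
        simp only [pushNode]
        split_ifs with hi
        · exact h 0 s i hi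
        · rfl
      · intro j s i hi
        rw [add_assoc, add_assoc]
        exact h (1 + j) s i hi

theorem forall_mem_scan (P : ℚ → Prop) (X : List (Option S)) (σ : ℕ → ℚ) (k : ℕ)
    (hσ : ∀ i, P (σ i)) (h : ∀ j s i, k ≤ j → i < ar s → P (childValue ar j s i)) :
    ∀ x ∈ scan ar X σ k, P x := by
  induction X generalizing σ k with
  | nil => simp [scan]
  | cons a X ih =>
    cases a with
    | none => exact ih _ _ (fun i => hσ _) h
    | some s =>
      rw [scan, List.forall_mem_cons]
      refine ⟨hσ 0, ih _ _ (fun i => ?_) fun j s i hj => h j s i (by omega)⟩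
      rw [pushNode]
      split_ifs with hi
      · exact h k s i le_rfl hi
      · exact hσ _

theorem length_scan (X : List (Option S)) (σ : ℕ → ℚ) (k : ℕ) :
    (scan ar X σ k).length = X.reduceOption.length := by
  induction X generalizing σ k with
  | nil => rfl
  | cons a X ih =>
    cases a with
    | none => rw [scan, ih, List.reduceOption_cons_of_none]
    | some s => simp [scan, ih, List.reduceOption_cons_of_some]

/-- The traversal of the beginning of a word leaves free positions with decreasing values, which
do not exceed the values of the positions coming later. -/
theorem exists_scan_append (X : List (Option S)) (σ : ℕ → ℚ) (k : ℕ) (h : Antitone σ)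
    (hk : ∀ i, σ i < k) :
    ∃ τ : ℕ → ℚ, Antitone τ ∧ (∀ i, τ i < (k + X.reduceOption.length : ℕ)) ∧
      ∀ Y, scan ar (X ++ Y) σ k = scan ar X σ k ++ scan ar Y τ (k + X.reduceOption.length) := by
  induction X generalizing σ k with
  | nil => exact ⟨σ, h, hk, fun Y => rfl⟩
  | cons a X ih =>
    cases a with
    | none => exact ih _ _ (fun i j hij => h (by omega)) fun i => hk _
    | some s =>
      obtain ⟨τ, h1, h2, h3⟩ := ih (pushNode ar k s σ) (k + 1) (pushNode_antitone s h hk)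
        (pushNode_lt s hk)
      have e : k + (some s :: X).reduceOption.length = k + 1 + X.reduceOption.length := by
        rw [List.reduceOption_cons_of_some, List.length_cons]
        omega
      rw [e]
      exact ⟨τ, h1, h2, fun Y => by rw [List.cons_append, scan, scan, h3, List.cons_append]⟩

theorem scan_append_replicate_none (X : List (Option S)) (q : ℕ) (σ : ℕ → ℚ) (k : ℕ) :
    scan ar (X ++ List.replicate q none) σ k = scan ar X σ k := by
  induction X generalizing σ k with
  | nil =>
    induction q generalizing σ with
    | zero => rfl
    | succ q ih => exact ih _
  | cons a X ih =>
    cases a with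
    | none => exact ih _ _
    | some s => rw [List.cons_append, scan, scan, ih]

/-! ### Effect of removing leaves on connection words -/

theorem cncFrom_mono (t : Term ar) {x y : ℚ} (h : x ≤ y) (k : ℕ) :
    List.Forall₂ (· ≤ ·) (t.cncFrom x k) (t.cncFrom y k) := by
  cases t with
  | leaf => exact List.Forall₂.nil
  | node s c => exact List.Forall₂.cons h (List.forall₂_refl _)

theorem scan_mono (L : List (Term ar)) {σ τ : ℕ → ℚ} (h : ∀ i, σ i ≤ τ i) (k : ℕ) :
    List.Forall₂ (· ≤ ·) (scan ar (L.flatMap traversal) σ k)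
      (scan ar (L.flatMap traversal) τ k) := by
  induction L generalizing σ τ k with
  | nil => exact List.Forall₂.nil
  | cons t L ih =>
    rw [scan_flatMap_traversal_cons, scan_flatMap_traversal_cons]
    exact List.rel_append (cncFrom_mono t (h 0) k) (ih (fun i => h _) _)

/-- Removing the leaves of a sequence of terms moves the other ones to the left. -/
theorem scan_le_scan_filter (L : List (Term ar)) {σ : ℕ → ℚ} (h : Antitone σ) (k : ℕ) :
    List.Forall₂ (· ≤ ·) (scan ar (L.flatMap traversal) σ k)
      (scan ar ((L.filter fun t => !t.isLeaf).flatMap traversal) σ k) := by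
  induction L generalizing σ k with
  | nil => exact List.Forall₂.nil
  | cons t L ih =>
    have hs : Antitone fun i => σ (i + 1) := fun i j hij => h (by omega)
    cases t with
    | leaf =>
      rw [List.filter_cons_of_neg (by simp [isLeaf])]
      -- Deleting a leading leaf gives its position to the next term: each free position `i + 1` is
      -- replaced with `i`, of larger or equal value.
      exact forall₂_trans (ih hs k) (scan_mono _ (fun i => h (by omega)) k)
    | node s c =>
      rw [List.filter_cons_of_pos (by simp [isLeaf]), scan_flatMap_traversal_cons,
        scan_flatMap_traversal_cons]
      exact List.rel_append (List.forall₂_refl _) (ih hs _)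

/-- When all free positions have the same value, skipping one of them has no effect. -/
theorem scan_filter_const (L : List (Term ar)) (x : ℚ) (k : ℕ) :
    scan ar ((L.filter fun t => !t.isLeaf).flatMap traversal) (fun _ => x) k =
      scan ar (L.flatMap traversal) (fun _ => x) k := by
  induction L generalizing k with
  | nil => rfl
  | cons t L ih =>
    cases t with
    | leaf =>
      rw [List.filter_cons_of_neg (by simp [isLeaf])]
      exact ih k
    | node s c =>
      rw [List.filter_cons_of_pos (by simp [isLeaf]), scan_flatMap_traversal_cons,
        scan_flatMap_traversal_cons, ih]

theorem scan_flatMap_traversal_append_const (L : List (Term ar)) (X : List (Option S)) (x : ℚ)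
    (k : ℕ) : scan ar (L.flatMap traversal ++ X) (fun _ => x) k =
      scan ar (L.flatMap traversal) (fun _ => x) k ++
        scan ar X (fun _ => x) (k + (L.map deg).sum) := by
  induction L generalizing k with
  | nil => rfl
  | cons t L ih =>
    rw [List.flatMap_cons, List.append_assoc, scan_traversal_append, scan_traversal_append, ih,
      List.append_assoc, List.map_cons, List.sum_cons, ← add_assoc]

/-! ### Terms rebuilt from a traversal -/

/-- The sequence of terms with a given traversal, completed with leaves if needed. -/
def parse (ar : S → ℕ) : List (Option S) → List (Term ar)
  | [] => []
  | none :: X => leaf :: parse ar X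
  | some s :: X => node s (fun i => (parse ar X).getD i leaf) :: (parse ar X).drop (ar s)

theorem parse_traversal_append (t : Term ar) (X : List (Option S)) :
    parse ar (t.traversal ++ X) = t :: parse ar X := by
  induction t generalizing X with
  | leaf => rfl
  | node s c ih =>
    have h : ∀ (n : ℕ) (c : Fin n → Term ar)
        (_ : ∀ i X, parse ar ((c i).traversal ++ X) = c i :: parse ar X),
        parse ar (((List.finRange n).flatMap fun i => (c i).traversal) ++ X) =
          List.ofFn c ++ parse ar X := by
      intro n
      induction n with
      | zero => intro c _; simp
      | succ n IH =>
        intro c hc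
        rw [List.finRange_succ, List.flatMap_cons, List.flatMap_map, List.append_assoc, hc,
          IH (fun i => c i.succ) fun i => hc i.succ, List.ofFn_succ, List.cons_append]
    rw [traversal, List.cons_append, parse, h _ c ih]
    congr 1
    · congr 1
      funext i
      rw [List.getD_append _ _ _ _ (by simp)]
      simp
    · exact List.drop_left' (by simp)

theorem parse_flatMap_traversal (L : List (Term ar)) : parse ar (L.flatMap traversal) = L := by
  induction L with
  | nil => rfl
  | cons t L ih => rw [List.flatMap_cons, parse_traversal_append, ih]

theorem ofFn_getD_append_drop {α : Type*} (L : List α) (x : α) (n : ℕ) :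
    (List.ofFn fun i : Fin n => L.getD i x) ++ L.drop n =
      L ++ List.replicate (n - L.length) x := by
  induction n generalizing L with
  | zero => simp
  | succ n ih =>
    rw [List.ofFn_succ]
    cases L with
    | nil => simp [List.replicate_succ]
    | cons y L => simpa using ih L

theorem exists_flatMap_traversal_parse (X : List (Option S)) :
    ∃ q, (parse ar X).flatMap traversal = X ++ List.replicate q none := by
  induction X with
  | nil => exact ⟨0, rfl⟩
  | cons a X ih =>
    obtain ⟨q, hq⟩ := ih
    cases a with
    | none => exact ⟨q, by rw [parse, List.flatMap_cons, hq]; rfl⟩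
    | some s =>
      -- The second summand counts the children of the new node that are missing in `X` and are
      -- filled with leaves.
      refine ⟨q + (ar s - (parse ar X).length), ?_⟩
      have h := congrArg (List.flatMap traversal)
        (ofFn_getD_append_drop (parse ar X) leaf (ar s))
      rw [List.flatMap_append, List.flatMap_append, hq] at h
      rw [parse, List.flatMap_cons, traversal, List.cons_append, List.cons_append,
        List.replicate_add, ← List.append_assoc]
      congr 1
      rw [List.ofFn_eq_map, List.flatMap_map] at h
      rw [h]
      simp [List.flatMap_def, traversal, List.flatten_replicate_singleton]

/-- Completion only adds leaves as children of internal nodes. A leaf that is itself an entry of the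
sequence was therefore visited in `X`, and is not changed by what follows. -/
theorem getElem?_parse_append (X Y : List (Option S)) (i : ℕ)
    (h : (parse ar X)[i]? = some leaf) : (parse ar (X ++ Y))[i]? = some leaf := by
  induction X generalizing i with
  | nil => simp [parse] at h
  | cons a X ih =>
    cases a with
    | none =>
      cases i with
      | zero => rfl
      | succ i => exact ih i (by simpa [parse] using h)
    | some s =>
      cases i with
      | zero => simp [parse] at h
      | succ i =>
        rw [List.cons_append, parse, List.getElem?_cons_succ, List.getElem?_drop]
        exact ih _ (by simpa [parse] using h)

/-- The prefixes of the traversal of a sequence of terms different from the leaf are traversals of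
such sequences. -/
theorem filter_parse_of_append {L : List (Term ar)} (hL : ∀ t ∈ L, t.isLeaf = false)
    {X Y : List (Option S)} (h : L.flatMap traversal = X ++ Y) :
    ((parse ar X).filter fun t => !t.isLeaf) = parse ar X := by
  rw [List.filter_eq_self]
  intro t ht
  cases t with
  | node s c => rfl
  | leaf =>
    obtain ⟨i, hi⟩ := List.mem_iff_getElem?.1 ht
    have h1 := getElem?_parse_append X Y i hi
    rw [← h, parse_flatMap_traversal] at h1
    simpa using hL _ (List.mem_iff_getElem?.2 ⟨i, h1⟩)

/-! ### Forests as terms, and relabelling of the children of the root -/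

theorem traversal_embed (t : Term ar) :
    t.embed.traversal = t.traversal.map (Option.map Sum.inl) := by
  induction t with
  | leaf => rfl
  | node s c ih =>
    rw [embed, traversal, traversal, List.map_cons, List.map_flatMap]
    exact congrArg _ (List.flatMap_congr fun i _ => ih i)

theorem dc_embed (t : Term ar) : t.embed.dc = t.dc.map Sum.inl := by
  induction t with
  | leaf => rfl
  | node s c ih =>
    rw [embed, dc, dc, List.map_cons, List.map_flatMap]
    exact congrArg _ (List.flatMap_congr fun i _ => ih i)

theorem cncFrom_embed (t : Term ar) (x : ℚ) (k : ℕ) : t.embed.cncFrom x k = t.cncFrom x k := by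
  induction t generalizing x k with
  | leaf => rfl
  | node s c ih =>
    rw [embed, cncFrom, cncFrom]
    refine congrArg _ (List.flatMap_congr fun i _ => ?_)
    simp only [deg_embed]
    exact ih i _ _

theorem le_of_mem_cncFrom (t : Term ar) {x : ℚ} {k l : ℕ} (hx : (l : ℚ) ≤ x) (hk : l ≤ k) :
    ∀ y ∈ t.cncFrom x k, (l : ℚ) ≤ y := by
  induction t generalizing x k with
  | leaf => simp [cncFrom]
  | node s c ih =>
    rw [cncFrom, List.forall_mem_cons]
    refine ⟨hx, fun y hy => ?_⟩
    obtain ⟨i, -, hy⟩ := List.mem_flatMap.1 hy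
    refine ih i ?_ (by omega) y hy
    have h1 := le_childValue (ar := ar) k s i.2
    have h2 : (l : ℚ) ≤ k := by exact_mod_cast hk
    exact h2.trans h1

/-- The replacement of the values less than `2` in a list, from left to right, with the values of
`σ`. -/
def relabel (σ : ℕ → ℚ) : List ℚ → List ℚ
  | [] => []
  | y :: Y => if y < 2 then σ 0 :: relabel (fun i => σ (i + 1)) Y else y :: relabel σ Y

theorem relabel_append_of_le (σ : ℕ → ℚ) {X : List ℚ} (hX : ∀ x ∈ X, 2 ≤ x) (Y : List ℚ) :
    relabel σ (X ++ Y) = X ++ relabel σ Y := by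
  induction X with
  | nil => rfl
  | cons x X ih =>
    rw [List.forall_mem_cons] at hX
    rw [List.cons_append, relabel, if_neg hX.1.not_gt, ih hX.2, List.cons_append]

/-- With free positions of value `1` and numbering from `k ≥ 2`, the values less than `2` are
exactly those of the roots of the terms of `L`. As no term is a leaf, the roots occupy consecutive
positions, so `σ` is read without gaps. -/
theorem relabel_scan (σ : ℕ → ℚ) (L : List (Term ar)) (hL : ∀ t ∈ L, t.isLeaf = false) (k : ℕ)
    (hk : 2 ≤ k) : relabel σ (scan ar (L.flatMap traversal) (fun _ => 1) k) =
      scan ar (L.flatMap traversal) σ k := by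
  induction L generalizing σ k with
  | nil => rfl
  | cons t L ih =>
    rw [List.forall_mem_cons] at hL
    rw [scan_flatMap_traversal_cons, scan_flatMap_traversal_cons]
    cases t with
    | leaf => exact absurd hL.1 (by simp [isLeaf])
    | node s c =>
      rw [cncFrom, List.cons_append, relabel, if_pos (by norm_num), relabel_append_of_le,
        ih _ hL.2 _ (by omega)]
      · rfl
      · intro y hy
        obtain ⟨i, -, hy⟩ := List.mem_flatMap.1 hy
        have h1 := le_childValue (ar := ar) k s i.2
        have h2 : (2 : ℚ) ≤ k := by exact_mod_cast hk
        have h3 := le_of_mem_cncFrom (l := 2) (c i) (by rw [Nat.cast_ofNat]; exact h2.trans h1)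
          (by omega) y hy
        rwa [Nat.cast_ofNat] at h3

theorem relabel_mono {X Y : List ℚ} (h : List.Forall₂ (· ≤ ·) X Y) {σ τ : ℕ → ℚ}
    (hστ : ∀ i, σ i ≤ τ i) (hσ : Antitone σ) (h2 : ∀ i, σ i < 2) :
    List.Forall₂ (· ≤ ·) (relabel σ X) (relabel τ Y) := by
  induction h generalizing σ τ with
  | nil => exact List.Forall₂.nil
  | @cons x y X Y hxy h ih =>
    have hs : Antitone fun i => σ (i + 1) := fun i j hij => hσ (by omega)
    rw [relabel, relabel]
    split_ifs with h3 h4 h4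
    · exact List.Forall₂.cons (hστ 0) (ih (fun i => hστ _) hs fun i => h2 _)
    -- Only the left word uses up a label here, so `σ` gets ahead of `τ`; the comparison survives
    -- because `σ` is decreasing.
    · exact List.Forall₂.cons ((h2 0).le.trans (not_lt.1 h4))
        (ih (fun i => (hσ (by omega)).trans (hστ i)) hs fun i => h2 _)
    · exact absurd (hxy.trans_lt h4) h3
    · exact List.Forall₂.cons hxy (ih hστ hσ h2)

theorem forall₂_map {φ : ℚ → ℚ} (h : Monotone φ) {X Y : List ℚ}
    (hXY : List.Forall₂ (· ≤ ·) X Y) : List.Forall₂ (· ≤ ·) (X.map φ) (Y.map φ) := by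
  rw [List.forall₂_map_left_iff, List.forall₂_map_right_iff]
  exact hXY.imp fun _ _ h' => h h'

theorem eq_filter_append_replicate {L : List (Term ar)}
    (hL : L.Pairwise fun t t' => t.isLeaf ≤ t'.isLeaf) :
    ∃ q, L = (L.filter fun t => !t.isLeaf) ++ List.replicate q leaf := by
  induction L with
  | nil => exact ⟨0, rfl⟩
  | cons t L ih =>
    rw [List.pairwise_cons] at hL
    cases t with
    | node s c =>
      obtain ⟨q, hq⟩ := ih hL.2
      refine ⟨q, ?_⟩
      rw [List.filter_cons_of_pos (by simp [isLeaf]), List.cons_append, ← hq]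
    | leaf =>
      have h : ∀ t ∈ L, t = leaf := by
        intro t ht
        have h1 := hL.1 t ht
        cases t with
        | leaf => rfl
        | node s c => exact absurd h1 (by simp [isLeaf])
      refine ⟨L.length + 1, ?_⟩
      rw [List.eq_replicate_of_mem h]
      simp [isLeaf, List.replicate_succ]

theorem flatMap_traversal_replicate_leaf (q : ℕ) :
    (List.replicate q (leaf : Term ar)).flatMap traversal = List.replicate q none := by
  simp [List.flatMap_def, traversal, List.flatten_replicate_singleton]

end Term

/-! ### The order on leaning forests in terms of the children which are not leaves -/

namespace LeaningForest

open Term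

variable {S : Type u} {ar : S → ℕ}

/-- The children of the root which are not leaves. -/
def core (f : LeaningForest ar) : List (Term ar) :=
  (List.ofFn f.1.sub).filter fun t => !t.isLeaf

/-- The preorder traversal, without the root and without the leaves which are its children. -/
def coreWord (f : LeaningForest ar) : List (Option S) := f.core.flatMap traversal

/-- The decoration word without the root. -/
def coreDc (f : LeaningForest ar) : List S := f.core.flatMap dc

/-- The connection word without the root, where the connection values of the children of the root
are replaced with `1`. -/
def coreCnc (f : LeaningForest ar) : List ℚ := scan ar f.coreWord (fun _ => 1) 2

theorem isLeaf_of_mem_core {f : LeaningForest ar} {t : Term ar} (h : t ∈ f.core) :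
    t.isLeaf = false := by
  simpa using (List.mem_filter.1 h).2

theorem ofFn_sub (f : LeaningForest ar) :
    ∃ q, List.ofFn f.1.sub = f.core ++ List.replicate q leaf := by
  refine eq_filter_append_replicate ?_
  rw [List.pairwise_ofFn]
  exact fun i j hij => (Forest.tilt_eq_iff f.1).1 f.2.2 hij.le

theorem flatMap_traversal_ofFn_sub (f : LeaningForest ar) : ∃ q,
    (List.ofFn f.1.sub).flatMap traversal = f.coreWord ++ List.replicate q none := by
  obtain ⟨q, hq⟩ := f.ofFn_sub
  exact ⟨q, by rw [hq, List.flatMap_append, flatMap_traversal_replicate_leaf, coreWord]⟩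

theorem coreCnc_eq_scan (f : LeaningForest ar) :
    f.coreCnc = scan ar ((List.ofFn f.1.sub).flatMap traversal) (fun _ => 1) 2 :=
  scan_filter_const _ _ _

theorem reduceOption_coreWord (f : LeaningForest ar) : f.coreWord.reduceOption = f.coreDc :=
  reduceOption_flatMap_traversal _

theorem coreDc_eq_flatMap (f : LeaningForest ar) : f.coreDc = (List.ofFn f.1.sub).flatMap dc := by
  obtain ⟨q, hq⟩ := f.ofFn_sub
  rw [hq, List.flatMap_append, coreDc, List.flatMap_def (f := dc) (l := List.replicate q leaf)]
  simp [dc]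

theorem sum_deg_core (f : LeaningForest ar) : (f.core.map deg).sum = f.1.n := by
  obtain ⟨q, hq⟩ := f.ofFn_sub
  have h := congrArg (fun L => (L.map deg).sum) hq
  simp only [List.map_append, List.sum_append, List.map_replicate, deg, List.sum_replicate,
    smul_zero, add_zero, List.map_ofFn, List.sum_ofFn, Function.comp_apply] at h
  rw [← h, (Forest.isBalanced_iff f.1).1 f.2.1]

theorem length_coreDc (f : LeaningForest ar) : f.coreDc.length = f.1.n := by
  rw [← f.sum_deg_core, coreDc, List.length_flatMap]
  simp only [length_dc]

theorem length_coreCnc (f : LeaningForest ar) : f.coreCnc.length = f.1.n := by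
  rw [coreCnc, length_scan, reduceOption_coreWord, length_coreDc]

theorem dc_toTerm (f : LeaningForest ar) :
    f.1.toTerm.dc = Sum.inr f.1.n :: f.coreDc.map Sum.inl := by
  rw [Forest.toTerm, dc, coreDc_eq_flatMap, List.ofFn_eq_map, List.flatMap_map, List.map_flatMap]
  exact congrArg _ (List.flatMap_congr fun i _ => dc_embed _)

/-- The connection values of the children of a root with `n` children. -/
def rootValue (n i : ℕ) : ℚ := childValue (id : ℕ → ℕ) 1 n i

theorem cnc_toTerm (f : LeaningForest ar) : f.1.toTerm.cnc =
    ((1 : ℚ) + 1 - 2 ^ ((0 : ℤ) - (f.1.n : ℤ))) :: scan ar f.coreWord (rootValue f.1.n) 2 := by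
  obtain ⟨q, hq⟩ := f.flatMap_traversal_ofFn_sub
  rw [← scan_append_replicate_none f.coreWord q, ← hq, Forest.toTerm, cnc, cncFrom]
  refine congrArg _ ?_
  have h := scan_flatMap_finRange f.1.sub (fun i => scan_traversal_append _) []
    (rootValue f.1.n) 2
  rw [List.append_nil, scan, List.append_nil] at h
  rw [List.ofFn_eq_map, List.flatMap_map, h]
  refine List.flatMap_congr fun i _ => ?_
  rw [cncFrom_embed]
  simp only [deg_embed]
  rw [rootValue, childValue]
  simp
  rfl

theorem rootValue_antitone (n : ℕ) : Antitone (rootValue n) := childValue_antitone _ _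

theorem rootValue_lt (n i : ℕ) : rootValue n i < 2 :=
  (childValue_lt _ _ _).trans_eq (by norm_num)

/-- Up to a shift by `n` of the node numbers, forgets the parents whose number is at most `n + 1`,
which are replaced with the root. -/
def collapse (n : ℕ) (y : ℚ) : ℚ := if y < n + 2 then 1 else y - n

theorem collapse_mono (n : ℕ) : Monotone (collapse n) := by
  intro x y hxy
  simp only [collapse]
  split_ifs <;> linarith

/-- The initial free positions fall below the threshold `n + 2` and are sent to `1`. The children of
a node numbered at least `n + 2` have values at least `n + 2`, which are only shifted. -/
theorem map_collapse_scan (n : ℕ) (X : List (Option S)) (σ : ℕ → ℚ) (hσ : ∀ i, σ i < n + 2) :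
    (scan ar X σ (n + 2)).map (collapse n) = scan ar X (fun _ => 1) 2 := by
  rw [map_scan (l := 2)]
  · congr 1
    funext i
    rw [collapse, if_pos (hσ i)]
  · intro j s i hi
    have h := le_childValue (ar := ar) (n + 2 + j) s hi
    push_cast at h
    rw [collapse, if_neg (by linarith [(Nat.cast_nonneg j : (0 : ℚ) ≤ j)]), childValue, childValue]
    push_cast
    ring

theorem eq_one_or_two_le_of_mem_coreCnc {f : LeaningForest ar} {x : ℚ} (h : x ∈ f.coreCnc) :
    x = 1 ∨ 2 ≤ x := by
  refine forall_mem_scan (fun x => x = 1 ∨ 2 ≤ x) _ _ _ (fun _ => Or.inl rfl) ?_ x h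
  intro j s i hj hi
  have h1 : (2 : ℚ) ≤ j := by exact_mod_cast hj
  exact Or.inr (h1.trans (le_childValue j s hi))

/-- The easterly wind order on leaning forests does not depend on the positions of the children of
the root. -/
theorem le_iff (f g : LeaningForest ar) :
    f ≤ g ↔ f.coreDc = g.coreDc ∧ List.Forall₂ (· ≤ ·) f.coreCnc g.coreCnc := by
  change f.1.toTerm.dc = g.1.toTerm.dc ∧ List.Forall₂ (· ≤ ·) f.1.toTerm.cnc g.1.toTerm.cnc ↔ _
  have hinl : Function.Injective (List.map (Sum.inl : S → S ⊕ ℕ)) :=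
    List.map_injective_iff.2 Sum.inl_injective
  rw [dc_toTerm, dc_toTerm, cnc_toTerm, cnc_toTerm, List.cons.injEq, List.forall₂_cons,
    hinl.eq_iff]
  constructor
  · rintro ⟨⟨-, h1⟩, -, h2⟩
    refine ⟨h1, ?_⟩
    -- Without any shift, collapsing sends the values less than `2`, those of the children of the
    -- root, to `1`.
    have h3 := forall₂_map (collapse_mono 0) h2
    have h4 := fun X => map_collapse_scan (ar := ar) 0 X
    simp only [zero_add] at h4
    rwa [h4 _ _ fun i => by simpa using rootValue_lt _ i,
      h4 _ _ fun i => by simpa using rootValue_lt _ i] at h3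
  · rintro ⟨h1, h2⟩
    have hn : f.1.n = g.1.n := by rw [← length_coreDc, h1, length_coreDc]
    refine ⟨⟨by rw [hn], h1⟩, by rw [hn], ?_⟩
    -- The true values of the children of the root are recovered from left to right; this works
    -- because leaning forests have no gaps among them.
    have h3 := relabel_mono h2 (fun _ => le_rfl) (rootValue_antitone f.1.n) (rootValue_lt f.1.n)
    rw [coreCnc, coreCnc, coreWord, coreWord,
      relabel_scan _ _ (fun t => isLeaf_of_mem_core) _ le_rfl,
      relabel_scan _ _ (fun t => isLeaf_of_mem_core) _ le_rfl] at h3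
    rw [← hn]
    exact h3

/-! ### Leaning forests with prescribed children or traversal -/

theorem length_filter_le_sum_deg (L : List (Term ar)) :
    (L.filter fun t => !t.isLeaf).length ≤ (L.map deg).sum := by
  induction L with
  | nil => simp
  | cons t L ih =>
    cases t with
    | leaf => simpa [isLeaf, deg] using ih
    | node s c =>
      rw [List.filter_cons_of_pos (by simp [isLeaf]), List.map_cons, List.sum_cons,
        List.length_cons, deg]
      omega

theorem sum_deg_filter (L : List (Term ar)) :
    ((L.filter fun t => !t.isLeaf).map deg).sum = (L.map deg).sum := by
  induction L with
  | nil => rfl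
  | cons t L ih =>
    cases t with
    | leaf => simpa [isLeaf, deg] using ih
    | node s c => simpa [isLeaf] using ih

/-- The forest obtained from a list of terms by removing the leaves, and adding at the end as many
leaves as needed. -/
def forestOfTerms (L : List (Term ar)) : Forest ar :=
  ⟨(L.map deg).sum, fun i => (L.filter fun t => !t.isLeaf).getD i leaf⟩

theorem ofFn_sub_forestOfTerms (L : List (Term ar)) : ∃ q, List.ofFn (forestOfTerms L).sub =
    (L.filter fun t => !t.isLeaf) ++ List.replicate q leaf := by
  refine ⟨_, Eq.trans ?_ (ofFn_getD_append_drop _ leaf (L.map deg).sum)⟩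
  rw [List.drop_eq_nil_of_le (length_filter_le_sum_deg L), List.append_nil]
  rfl

theorem isLeaning_forestOfTerms (L : List (Term ar)) : (forestOfTerms L).IsLeaning := by
  obtain ⟨q, hq⟩ := ofFn_sub_forestOfTerms L
  refine ⟨?_, ?_⟩
  · have h := congrArg (fun L => (L.map deg).sum) hq
    simp only [List.map_append, List.sum_append, List.map_replicate, deg, List.sum_replicate,
      smul_zero, add_zero, List.map_ofFn, List.sum_ofFn, Function.comp_apply,
      sum_deg_filter] at h
    rw [Forest.isBalanced_iff, h]
    rfl
  · rw [Forest.tilt_eq_iff]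
    have h : (List.ofFn (forestOfTerms L).sub).Pairwise fun t t' => t.isLeaf ≤ t'.isLeaf := by
      rw [hq, List.pairwise_append]
      refine ⟨List.pairwise_of_forall_mem_list ?_, ?_, ?_⟩
      · intro t ht t' _
        have h1 := (List.mem_filter.1 ht).2
        simp only [Bool.not_eq_true'] at h1
        rw [h1]
        exact Bool.false_le _
      · exact List.pairwise_replicate.2 (Or.inr le_rfl)
      · intro t ht t' ht'
        rw [List.eq_of_mem_replicate ht']
        exact Bool.le_true _
    rw [List.pairwise_ofFn] at h
    intro i j hij
    rcases hij.eq_or_lt with rfl | hij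
    · exact le_rfl
    · exact h hij

/-- The leaning forest of the terms of a list which are not leaves. -/
def ofTerms (L : List (Term ar)) : LeaningForest ar :=
  ⟨forestOfTerms L, isLeaning_forestOfTerms L⟩

theorem core_ofTerms (L : List (Term ar)) :
    (ofTerms L).core = L.filter fun t => !t.isLeaf := by
  obtain ⟨q, hq⟩ := ofFn_sub_forestOfTerms L
  change (List.ofFn (forestOfTerms L).sub).filter _ = _
  rw [hq, List.filter_append, List.filter_filter]
  simp [isLeaf]

/-- The leaning forest with a given traversal. -/
def ofWord (X : List (Option S)) : LeaningForest ar := ofTerms (parse ar X)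

/-- Neither the leaves added at the end of the word nor the removal of leaves at the root is seen by
`scan` with constant free positions. -/
theorem coreCnc_ofWord (X : List (Option S)) :
    (ofWord X : LeaningForest ar).coreCnc = scan ar X (fun _ => 1) 2 := by
  obtain ⟨q, hq⟩ := exists_flatMap_traversal_parse (ar := ar) X
  rw [coreCnc, coreWord, ofWord, core_ofTerms, scan_filter_const, hq, scan_append_replicate_none]

theorem coreDc_ofWord (X : List (Option S)) :
    (ofWord X : LeaningForest ar).coreDc = X.reduceOption := by
  obtain ⟨q, hq⟩ := exists_flatMap_traversal_parse (ar := ar) X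
  have h : X.reduceOption = (parse ar X).flatMap dc := by
    rw [← reduceOption_flatMap_traversal, hq, List.reduceOption_append,
      List.reduceOption_replicate_none, List.append_nil]
  rw [coreDc, ofWord, core_ofTerms, h]
  induction parse ar X with
  | nil => rfl
  | cons t L ih =>
    cases t with
    | leaf => simpa [isLeaf, dc] using ih
    | node s c => simpa [isLeaf, dc] using ih

end LeaningForest

/-! ### Traversals of substitutions, tiltings and graftings -/

namespace Term

variable {S : Type u} {ar : S → ℕ}

/-- The substitution of the leaves visited by a traversal, from left to right, with `g 0`,
`g 1`, … -/
def substWord : List (Option S) → (ℕ → Term ar) → List (Option S)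
  | [], _ => []
  | none :: X, g => (g 0).traversal ++ substWord X fun m => g (m + 1)
  | some s :: X, g => some s :: substWord X g

theorem substWord_flatMap_finRange {n : ℕ} (c : Fin n → Term ar)
    (ih : ∀ i (X : List (Option S)) (g : ℕ → Term ar), substWord ((c i).traversal ++ X) g =
      ((c i).subst g).traversal ++ substWord X fun m => g ((c i).arity + m))
    (X : List (Option S)) (g : ℕ → Term ar) :
    substWord (((List.finRange n).flatMap fun i => (c i).traversal) ++ X) g =
      ((List.finRange n).flatMap fun i =>
        ((c i).subst fun m => g ((∑ j ∈ Finset.Iio i, (c j).arity) + m)).traversal) ++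
        substWord X fun m => g ((∑ i, (c i).arity) + m) := by
  induction n generalizing g with
  | zero => simp
  | succ n IH =>
    rw [List.finRange_succ, List.flatMap_cons, List.flatMap_cons, List.flatMap_map,
      List.flatMap_map, List.append_assoc, ih, IH (fun i => c i.succ) fun i => ih i.succ,
      List.append_assoc]
    have h0 : Finset.Iio (0 : Fin (n + 1)) = ∅ := by
      ext j
      simp
    simp only [sum_Iio_succ, Fin.sum_univ_succ, ← add_assoc]
    rw [h0, Finset.sum_empty]
    simp only [zero_add]

theorem substWord_traversal_append (t : Term ar) (X : List (Option S)) (g : ℕ → Term ar) :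
    substWord (t.traversal ++ X) g =
      (t.subst g).traversal ++ substWord X fun m => g (t.arity + m) := by
  induction t generalizing X g with
  | leaf => simp [traversal, substWord, subst, arity, add_comm]
  | node s c ih =>
    rw [traversal, List.cons_append, substWord, substWord_flatMap_finRange c ih]
    rfl

theorem substWord_append_of_leaf (X Y : List (Option S)) (g : ℕ → Term ar)
    (h : ∀ m < X.countP Option.isNone, g m = leaf) :
    substWord (X ++ Y) g = X ++ substWord Y fun m => g (X.countP Option.isNone + m) := by
  induction X generalizing g with
  | nil => simp
  | cons a X ih =>
    cases a with
    | none =>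
      simp only [List.countP_cons, Option.isNone_none, if_true] at h ⊢
      rw [List.cons_append, substWord, h 0 (by omega), ih _ fun m hm => h _ (by omega)]
      simp only [add_right_comm]
      rfl
    | some s =>
      simp only [List.countP_cons, Option.isNone_some, Bool.false_eq_true, if_false,
        add_zero] at h ⊢
      rw [List.cons_append, substWord, ih g h, List.cons_append]

theorem substWord_replicate_none (n : ℕ) (g : ℕ → Term ar) :
    substWord (List.replicate n none) g =
      (List.ofFn fun i : Fin n => g i).flatMap traversal := by
  induction n generalizing g with
  | zero => rfl
  | succ n ih =>
    rw [List.replicate_succ, substWord, ih, List.ofFn_succ, List.flatMap_cons]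
    rfl

theorem exists_eq_rdropWhile_append (X : List (Option S)) :
    X = X.rdropWhile Option.isNone ++
      List.replicate (X.reverse.takeWhile Option.isNone).length none := by
  conv_lhs => rw [← List.rdropWhile_append_rtakeWhile (p := Option.isNone) (l := X)]
  congr 1
  rw [List.eq_replicate_iff]
  refine ⟨by simp [List.rtakeWhile], fun a ha => ?_⟩
  simpa using List.mem_rtakeWhile_imp ha

theorem rdropWhile_append_replicate_none (X : List (Option S)) (q : ℕ) :
    (X ++ List.replicate q none).rdropWhile Option.isNone = X.rdropWhile Option.isNone := by
  induction q with
  | zero => simp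
  | succ q ih =>
    rw [List.replicate_succ', ← List.append_assoc, List.rdropWhile_concat_pos _ _ _ (by rfl), ih]

theorem reduceOption_rdropWhile (X : List (Option S)) :
    (X.rdropWhile Option.isNone).reduceOption = X.reduceOption := by
  conv_rhs => rw [exists_eq_rdropWhile_append X]
  rw [List.reduceOption_append, List.reduceOption_replicate_none, List.append_nil]

/-- This is the stability of the sort: the indices of the terms different from the leaf stay in
increasing order, and two increasing lists that are permutations of each other are equal. -/
theorem filter_ofFn_comp_sort {n : ℕ} (c : Fin n → Term ar) :
    (List.ofFn (c ∘ Tuple.sort fun i => (c i).isLeaf)).filter (fun t => !t.isLeaf) =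
      (List.ofFn c).filter fun t => !t.isLeaf := by
  set σ := Tuple.sort fun i => (c i).isLeaf with hσ
  have hs := (Tuple.eq_sort_iff.1 hσ).2
  rw [List.ofFn_eq_map, List.ofFn_eq_map, ← List.map_map,
    List.filter_map (f := c) (l := List.finRange n),
    List.filter_map (f := c) (l := (List.finRange n).map σ)]
  congr 1
  refine List.Perm.eq_of_pairwise (le := (· < ·)) (fun a b _ _ h h' => (lt_asymm h h').elim) ?_
    ((List.pairwise_lt_finRange n).filter _) (σ.map_finRange_perm.filter _)
  rw [List.filter_map, List.pairwise_map]
  refine ((List.pairwise_lt_finRange n).filter _).imp_of_mem fun {i j} hi hj hij => hs i j hij ?_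
  have h1 := (List.mem_filter.1 hi).2
  have h2 := (List.mem_filter.1 hj).2
  simp only [Function.comp_apply, Bool.not_eq_true'] at h1 h2
  exact h1.trans h2.symm

end Term

namespace Forest

open Term

variable {S : Type u} {ar : S → ℕ}

/-- The root is an internal node visited first, so it never contributes to the final run of leaves.
-/
theorem numExtreme_toTerm (f : Forest ar) : f.toTerm.numExtreme =
    (((List.ofFn f.sub).flatMap traversal).reverse.takeWhile Option.isNone).length := by
  rw [numExtreme, traversal_toTerm, List.reverse_cons]
  have h : ((List.finRange f.n).flatMap fun i => (f.sub i).embed.traversal) =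
      ((List.ofFn f.sub).flatMap traversal).map (Option.map Sum.inl) := by
    rw [List.ofFn_eq_map, List.flatMap_map, List.map_flatMap]
    exact List.flatMap_congr fun i _ => traversal_embed _
  rw [h, ← List.map_reverse]
  have h2 : (Option.isNone ∘ Option.map (Sum.inl : S → S ⊕ ℕ)) = Option.isNone := by
    funext a
    cases a <;> rfl
  rw [List.takeWhile_append, List.takeWhile_map, h2]
  split_ifs with h3
  · simp only [List.length_append, List.length_map] at h3 ⊢
    rw [h3]
    simp
  · simp

theorem countP_flatMap_traversal (f : Forest ar) :
    ((List.ofFn f.sub).flatMap traversal).countP Option.isNone = f.toTerm.arity := by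
  rw [arity_toTerm, List.countP_flatMap, List.map_ofFn, List.sum_ofFn]
  exact Finset.sum_congr rfl fun i _ => count_traversal _

/-- The extreme leaves are the final run of leaves of the traversal. As `h` has exactly one child
for each of them, the whole run is replaced with the traversals of these children. -/
theorem flatMap_traversal_graftExtreme (f h : Forest ar) (hn : h.n = f.toTerm.numExtreme) :
    (List.ofFn (f.graftExtreme h).sub).flatMap traversal =
      ((List.ofFn f.sub).flatMap traversal).rdropWhile Option.isNone ++
        (List.ofFn h.sub).flatMap traversal := by
  set W := (List.ofFn f.sub).flatMap traversal with hW
  set g : ℕ → Term ar := fun m =>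
    if f.toTerm.arity - f.toTerm.numExtreme ≤ m then
      if hj : m - (f.toTerm.arity - f.toTerm.numExtreme) < h.n then h.sub ⟨_, hj⟩ else leaf
    else leaf with hg
  have e1 : (List.ofFn (f.graftExtreme h).sub).flatMap traversal = substWord W g := by
    have := substWord_flatMap_finRange f.sub (fun i => substWord_traversal_append _) [] g
    rw [List.append_nil, substWord, List.append_nil] at this
    rw [hW, List.ofFn_eq_map (f := f.sub), List.flatMap_map, this, List.ofFn_eq_map,
      List.flatMap_map]
    rfl
  have e2 := exists_eq_rdropWhile_append W
  rw [← numExtreme_toTerm, ← hn] at e2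
  have e3 : (W.rdropWhile Option.isNone).countP Option.isNone =
      f.toTerm.arity - f.toTerm.numExtreme := by
    rw [← countP_flatMap_traversal, ← hW, ← hn]
    conv_rhs => rw [e2]
    simp [List.countP_replicate]
  rw [e1]
  conv_lhs => rw [e2]
  rw [substWord_append_of_leaf, substWord_replicate_none]
  · congr 3
    funext i
    simp only [hg, e3, le_add_iff_nonneg_right, zero_le, if_true, add_tsub_cancel_left,
      dif_pos i.2]
  · intro m hm
    rw [e3] at hm
    exact if_neg (by omega)

theorem ofFn_sub_concat (f h : Forest ar) :
    List.ofFn (f.concat h).sub = List.ofFn f.sub ++ List.ofFn h.sub :=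
  List.ofFn_fin_append _ _

theorem flatMap_traversal_concat_corolla (f : Forest ar) (n : ℕ) :
    (List.ofFn (f.concat (corolla n)).sub).flatMap traversal =
      (List.ofFn f.sub).flatMap traversal ++ List.replicate n none := by
  rw [ofFn_sub_concat, List.flatMap_append, ← flatMap_traversal_replicate_leaf (ar := ar),
    ← List.ofFn_const]
  rfl

end Forest

/-! ### Connection words of over and under -/

namespace LeaningForest

open Term

variable {S : Type u} {ar : S → ℕ}

theorem core_overOp (f g : LeaningForest ar) : (f.overOp g).core = f.core ++ g.core := by
  change (List.ofFn ((f.1.concat g.1).sub ∘ Tuple.sort fun i =>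
    ((f.1.concat g.1).sub i).isLeaf)).filter _ = _
  rw [filter_ofFn_comp_sort, Forest.ofFn_sub_concat, List.filter_append]
  rfl

theorem map_val_word (f : LeaningForest ar) : f.word.toList.map Subtype.val = f.core := by
  rw [word, FreeMonoid.toList_ofList, List.map_filterMap, core, ← List.filterMap_eq_filter]
  refine List.filterMap_congr fun t _ => ?_
  cases t <;> simp [isLeaf, Option.guard]

theorem word_overOp (f g : LeaningForest ar) : (f.overOp g).word = f.word * g.word := by
  refine FreeMonoid.toList.injective ?_
  refine List.map_injective_iff.2 Subtype.val_injective ?_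
  rw [FreeMonoid.toList_mul, List.map_append, map_val_word, map_val_word, map_val_word,
    core_overOp]

theorem coreDc_overOp (f g : LeaningForest ar) : (f.overOp g).coreDc = f.coreDc ++ g.coreDc := by
  rw [coreDc, core_overOp, List.flatMap_append]
  rfl

/-- Shifts the node numbers by `n`, except for the root. -/
def expand (n : ℕ) (y : ℚ) : ℚ := if y < 2 then y else y + n

theorem coreCnc_overOp (f g : LeaningForest ar) :
    (f.overOp g).coreCnc = f.coreCnc ++ g.coreCnc.map (expand f.1.n) := by
  rw [coreCnc, coreWord, core_overOp, List.flatMap_append, scan_flatMap_traversal_append_const,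
    sum_deg_core]
  change f.coreCnc ++ _ = f.coreCnc ++ (scan ar g.coreWord (fun _ => 1) 2).map _
  rw [map_scan (l := 2 + f.1.n)]
  · simp only [expand]
    norm_num
    rfl
  · intro j s i hi
    have h := le_childValue (ar := ar) (2 + j) s hi
    push_cast at h
    rw [expand, if_neg (by linarith [(Nat.cast_nonneg j : (0 : ℚ) ≤ j)]), childValue, childValue]
    push_cast
    ring

/-- The corollas in the definition of under only provide enough extreme leaves and enough subterms
to graft; on traversals they only affect the number of trailing leaves. -/
theorem flatMap_traversal_underOp (f g : LeaningForest ar) : ∃ q,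
    (List.ofFn (f.underOp g).1.sub).flatMap traversal =
      (f.coreWord.rdropWhile Option.isNone ++ g.coreWord) ++ List.replicate q none := by
  obtain ⟨q, hq⟩ := f.flatMap_traversal_ofFn_sub
  obtain ⟨r, hr⟩ := g.flatMap_traversal_ofFn_sub
  refine ⟨r + f.1.toTerm.numExtreme, ?_⟩
  rw [underOp, Forest.flatMap_traversal_graftExtreme _ _
    (Forest.numExtreme_concat_corolla _ _).symm, Forest.flatMap_traversal_concat_corolla,
    Forest.flatMap_traversal_concat_corolla, rdropWhile_append_replicate_none, hq, hr,
    rdropWhile_append_replicate_none, List.replicate_add, List.append_assoc, List.append_assoc]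

theorem coreCnc_underOp (f g : LeaningForest ar) : (f.underOp g).coreCnc =
    scan ar (f.coreWord.rdropWhile Option.isNone ++ g.coreWord) (fun _ => 1) 2 := by
  obtain ⟨q, hq⟩ := flatMap_traversal_underOp f g
  rw [coreCnc_eq_scan, hq, scan_append_replicate_none]

theorem coreDc_underOp (f g : LeaningForest ar) :
    (f.underOp g).coreDc = f.coreDc ++ g.coreDc := by
  obtain ⟨q, hq⟩ := flatMap_traversal_underOp f g
  rw [coreDc_eq_flatMap, ← reduceOption_flatMap_traversal, hq, List.reduceOption_append,
    List.reduceOption_append, reduceOption_rdropWhile, List.reduceOption_replicate_none,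
    List.append_nil, reduceOption_coreWord, reduceOption_coreWord]

theorem scan_rdropWhile_coreWord (f : LeaningForest ar) :
    scan ar (f.coreWord.rdropWhile Option.isNone) (fun _ => 1) 2 = f.coreCnc := by
  rw [coreCnc]
  conv_rhs => rw [exists_eq_rdropWhile_append f.coreWord]
  rw [scan_append_replicate_none]

/-- The connection values of the two parts of a traversal. -/
theorem take_drop_scan (X Y : List (Option S)) :
    (scan ar (X ++ Y) (fun _ => 1) 2).take X.reduceOption.length = scan ar X (fun _ => 1) 2 ∧
      ((scan ar (X ++ Y) (fun _ => 1) 2).drop X.reduceOption.length).map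
        (collapse X.reduceOption.length) = scan ar Y (fun _ => 1) 2 := by
  obtain ⟨τ, -, h2, h3⟩ := exists_scan_append (ar := ar) X (fun _ => 1) 2
    (fun _ _ _ => le_rfl) (fun _ => by norm_num)
  have hl := length_scan (ar := ar) X (fun _ => 1) 2
  rw [h3, ← hl, List.take_left', List.drop_left', hl, add_comm 2, map_collapse_scan]
  · exact ⟨rfl, rfl⟩
  · intro i
    have := h2 i
    push_cast at this
    linarith
  all_goals rfl

/-- The restrictions of `f under g` are `f` and `g`. -/
theorem take_drop_coreCnc_underOp (f g : LeaningForest ar) :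
    (f.underOp g).coreCnc.take f.coreDc.length = f.coreCnc ∧
      ((f.underOp g).coreCnc.drop f.coreDc.length).map (collapse f.coreDc.length) =
        g.coreCnc := by
  have h := take_drop_scan (ar := ar) (f.coreWord.rdropWhile Option.isNone) g.coreWord
  rwa [reduceOption_rdropWhile, reduceOption_coreWord, ← coreCnc_underOp,
    scan_rdropWhile_coreWord] at h

/-! ### Restrictions, and their adjunction with over -/

/-- The restrictions of a leaning forest to its first internal nodes, and to its other ones. -/
theorem exists_restrict (f : LeaningForest ar) (a b : List S) (h : f.coreDc = a ++ b) :
    ∃ g₁ g₂ : LeaningForest ar, g₁.coreDc = a ∧ g₂.coreDc = b ∧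
      f.coreCnc.take a.length = g₁.coreCnc ∧
      (f.coreCnc.drop a.length).map (collapse a.length) = g₂.coreCnc ∧ f ≤ g₁.underOp g₂ := by
  obtain ⟨X, Y, hXY, hX, hY, hr⟩ : ∃ X Y, f.coreWord = X ++ Y ∧ X.reduceOption = a ∧
      Y.reduceOption = b ∧ X.rdropWhile Option.isNone = X := by
    rw [← reduceOption_coreWord, List.reduceOption, List.filterMap_eq_append_iff] at h
    obtain ⟨X, Y, h1, h2, h3⟩ := h
    have h4 := exists_eq_rdropWhile_append X
    -- The cut can be made anywhere between two consecutive internal nodes. It is made just after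
    -- the last node of the first part, so that `X` is what under keeps of the first forest.
    refine ⟨X.rdropWhile Option.isNone,
      List.replicate (X.reverse.takeWhile Option.isNone).length none ++ Y, ?_, ?_, ?_, ?_⟩
    · rw [h1, ← List.append_assoc, ← h4]
    · rw [reduceOption_rdropWhile]
      exact h2
    · rw [List.reduceOption_append, List.reduceOption_replicate_none]
      exact h3
    · exact List.rdropWhile_idempotent _ _
  have hf : f.coreCnc = scan ar (X ++ Y) (fun _ => 1) 2 := by rw [coreCnc, hXY]
  have h1 := take_drop_scan (ar := ar) X Y
  rw [hX, ← hf] at h1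
  refine ⟨ofWord X, ofWord Y, by rw [coreDc_ofWord, hX], by rw [coreDc_ofWord, hY],
    by rw [coreCnc_ofWord, h1.1], by rw [coreCnc_ofWord, h1.2], ?_⟩
  rw [le_iff, coreDc_underOp, coreDc_ofWord, coreDc_ofWord, hX, hY, coreCnc_underOp]
  refine ⟨h, ?_⟩
  have e1 : (ofWord X : LeaningForest ar).coreWord.rdropWhile Option.isNone = X := by
    rw [coreWord, ofWord, core_ofTerms,
      filter_parse_of_append (fun t ht => isLeaf_of_mem_core ht) hXY]
    obtain ⟨q, hq⟩ := exists_flatMap_traversal_parse (ar := ar) X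
    rw [hq, rdropWhile_append_replicate_none, hr]
  -- Unlike for `X`, leaves are really lost here: a leaf of `f` on a position left free by `X`
  -- becomes a leaf at the root of the second restriction. This loss is what may make `f` smaller
  -- than the under forest.
  have e2 : (ofWord Y : LeaningForest ar).coreWord =
      ((parse ar Y).filter fun t => !t.isLeaf).flatMap traversal := by
    rw [coreWord, ofWord, core_ofTerms]
  obtain ⟨q, hq⟩ := exists_flatMap_traversal_parse (ar := ar) Y
  obtain ⟨τ, h4, -, h5⟩ := exists_scan_append (ar := ar) X (fun _ => 1) 2
    (fun _ _ _ => le_rfl) (fun _ => by norm_num)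
  rw [e1, e2, hf, h5, h5, ← scan_append_replicate_none Y q, ← hq]
  exact List.rel_append (List.forall₂_refl _) (scan_le_scan_filter _ h4 _)

theorem one_le_of_mem_coreCnc {f : LeaningForest ar} {x : ℚ} (h : x ∈ f.coreCnc) : 1 ≤ x := by
  rcases eq_one_or_two_le_of_mem_coreCnc h with rfl | h
  · exact le_rfl
  · linarith

/-- On the values that occur, `collapse n` is the upper adjoint of `expand n`: the value `1` is
below everything, and a value `x ≥ 2` is moved to at least `n + 2`, where both functions are
translations. -/
theorem forall₂_map_expand_iff (n : ℕ) {U V : List ℚ} (hU : ∀ x ∈ U, x = 1 ∨ 2 ≤ x)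
    (hV : ∀ x ∈ V, 1 ≤ x) :
    List.Forall₂ (· ≤ ·) (U.map (expand n)) V ↔ List.Forall₂ (· ≤ ·) U (V.map (collapse n)) := by
  have hn : (0 : ℚ) ≤ n := Nat.cast_nonneg n
  induction U generalizing V with
  | nil => cases V <;> simp
  | cons x U ih =>
    cases V with
    | nil => simp
    | cons y V =>
      rw [List.forall_mem_cons] at hU hV
      rw [List.map_cons, List.map_cons, List.forall₂_cons, List.forall₂_cons]
      refine and_congr ?_ (ih hU.2 hV.2)
      obtain ⟨hx, -⟩ := hU
      obtain ⟨hy, -⟩ := hV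
      simp only [expand, collapse]
      rcases hx with rfl | hx
      · rw [if_pos (by norm_num)]
        split_ifs
        · simpa using hy
        · exact ⟨fun _ => by linarith, fun _ => hy⟩
      · rw [if_neg hx.not_gt]
        split_ifs
        · exact ⟨fun _ => by linarith, fun _ => by linarith⟩
        · rw [le_sub_iff_add_le]

/-- The connection word of over consists of two independent blocks. The first one is compared
directly, the second one through the adjunction of `expand` and `collapse`. -/
theorem overOp_le_iff {f g₁ g₂ f₁ f₂ : LeaningForest ar} {a b : List S} (h : f.coreDc = a ++ b)
    (hg₁ : g₁.coreDc = a) (hg₂ : g₂.coreDc = b) (hf₁ : f₁.coreDc = a) (hf₂ : f₂.coreDc = b)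
    (h₁ : f.coreCnc.take a.length = g₁.coreCnc)
    (h₂ : (f.coreCnc.drop a.length).map (collapse a.length) = g₂.coreCnc) :
    f₁.overOp f₂ ≤ f ↔ f₁ ≤ g₁ ∧ f₂ ≤ g₂ := by
  have hn : f₁.1.n = a.length := by rw [← length_coreDc, hf₁]
  have hl : f₁.coreCnc.length = a.length := by rw [length_coreCnc, hn]
  rw [le_iff, le_iff, le_iff, coreDc_overOp, hf₁, hf₂, h, hg₁, hg₂, coreCnc_overOp, ← h₁, ← h₂, hn]
  simp only [true_and]
  rw [← forall₂_map_expand_iff _ (fun x hx => eq_one_or_two_le_of_mem_coreCnc hx)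
    fun x hx => one_le_of_mem_coreCnc (List.mem_of_mem_drop hx)]
  constructor
  · intro h3
    have h4 := List.forall₂_take a.length h3
    have h5 := List.forall₂_drop a.length h3
    rw [List.take_left' hl] at h4
    rw [List.drop_left' hl] at h5
    exact ⟨h4, h5⟩
  · rintro ⟨h4, h5⟩
    have h6 := List.rel_append h4 h5
    simp only [List.take_append_drop] at h6
    exact h6

/-- The forests which are at least `f₁ over f₂` are described by pairs of forests `g₁ ≥ f₁` and
`g₂ ≥ f₂`. -/
theorem exists_overOp_le_iff {f f₁ f₂ : LeaningForest ar} (h : f₁.overOp f₂ ≤ f) :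
    ∃ g₁ g₂ : LeaningForest ar, (∀ f₁' f₂', f₁ ≤ f₁' → f₂ ≤ f₂' →
      (f₁'.overOp f₂' ≤ f ↔ f₁' ≤ g₁ ∧ f₂' ≤ g₂)) ∧
      (f ≤ f₁.underOp f₂ ↔ f₁ = g₁ ∧ f₂ = g₂) := by
  have hd : f.coreDc = f₁.coreDc ++ f₂.coreDc := by
    rw [← ((le_iff _ _).1 h).1, coreDc_overOp]
  obtain ⟨g₁, g₂, hg₁, hg₂, h₁, h₂, hu⟩ := exists_restrict f _ _ hd
  have key : ∀ f₁' f₂', f₁ ≤ f₁' → f₂ ≤ f₂' →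
      -- The inequalities `h3` and `h4` only serve to fix the decoration words.
      (f₁'.overOp f₂' ≤ f ↔ f₁' ≤ g₁ ∧ f₂' ≤ g₂) := fun f₁' f₂' h3 h4 =>
    overOp_le_iff hd hg₁ hg₂ ((le_iff _ _).1 h3).1.symm ((le_iff _ _).1 h4).1.symm h₁ h₂
  refine ⟨g₁, g₂, key, fun h3 => ?_, ?_⟩
  · have h4 := (key _ _ le_rfl le_rfl).1 h
    have h5 := take_drop_coreCnc_underOp f₁ f₂
    have h6 := ((le_iff _ _).1 h3).2
    refine ⟨le_antisymm h4.1 ((le_iff _ _).2 ⟨hg₁, ?_⟩),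
      le_antisymm h4.2 ((le_iff _ _).2 ⟨hg₂, ?_⟩)⟩
    · rw [← h₁, ← h5.1]
      exact List.forall₂_take _ h6
    · rw [← h₂, ← h5.2]
      exact forall₂_map (collapse_mono _) (List.forall₂_drop _ h6)
  · rintro ⟨rfl, rfl⟩
    exact hu

theorem overOp_mono {f₁ f₂ f₁' f₂' : LeaningForest ar} (h₁ : f₁ ≤ f₁') (h₂ : f₂ ≤ f₂') :
    f₁.overOp f₂ ≤ f₁'.overOp f₂' := by
  rw [le_iff] at *
  have hn : f₁.1.n = f₁'.1.n := by rw [← length_coreDc, h₁.1, length_coreDc]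
  rw [coreDc_overOp, coreDc_overOp, coreCnc_overOp, coreCnc_overOp, h₁.1, h₂.1, hn]
  refine ⟨rfl, List.rel_append h₁.2 (forall₂_map (fun x y hxy => ?_) h₂.2)⟩
  simp only [expand]
  have : (0 : ℚ) ≤ f₁'.1.n := Nat.cast_nonneg _
  split_ifs <;> linarith

end LeaningForest

/-! ### Möbius inversion and the product formula -/

namespace NaturalAlgebra

variable (K : Type v) [Field K] {S : Type u} {ar : S → ℕ}

theorem E_mul_E (f g : LeaningForest ar) : E K f * E K g = E K (f.overOp g) := by
  rw [E, E, E, MonoidAlgebra.single_mul_single, mul_one, LeaningForest.word_overOp]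

/-- The elementary basis in terms of the fundamental basis, by Möbius inversion. -/
theorem sum_F (f : LeaningForest ar) : ∑ g ∈ Finset.Ici f, F K g = E K f := by
  classical
  simp only [F]
  rw [Finset.sum_comm' (t' := Finset.Ici f) (s' := fun g => Finset.Icc f g)]
  · simp only [← Finset.sum_smul]
    rw [Finset.sum_eq_single f]
    · rw [IncidenceAlgebra.sum_Icc_mu_left, if_pos rfl, one_smul]
    · intro g _ hg
      rw [IncidenceAlgebra.sum_Icc_mu_left, if_neg (Ne.symm hg), zero_smul]
    · simp
  · intro g g'
    simp only [Finset.mem_Ici, Finset.mem_Icc]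
    exact ⟨fun h => ⟨h, h.1.trans h.2⟩, fun h => h.1⟩

end NaturalAlgebra

theorem mainTheorem1 (K : Type v) [Field K] {S : Type u} (ar : S → ℕ)
    (f₁ f₂ : LeaningForest ar) :
    NaturalAlgebra.F K f₁ * NaturalAlgebra.F K f₂ =
      ∑ f ∈ Finset.Icc (f₁.overOp f₂) (f₁.underOp f₂), NaturalAlgebra.F K f := by
  classical
  -- All the expansions are written over the same upper set, with a condition on the terms, so that
  -- the sums over `p` and over `f` can be exchanged.
  have h1 : ∀ p ∈ Finset.Ici f₁ ×ˢ Finset.Ici f₂, NaturalAlgebra.E K (p.1.overOp p.2) =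
      ∑ f ∈ Finset.Ici (f₁.overOp f₂), if p.1.overOp p.2 ≤ f then NaturalAlgebra.F K f else 0 := by
    intro p hp
    simp only [Finset.mem_product, Finset.mem_Ici] at hp
    rw [← Finset.sum_filter, ← NaturalAlgebra.sum_F]
    refine Finset.sum_congr ?_ fun _ _ => rfl
    ext f
    simp only [Finset.mem_Ici, Finset.mem_filter]
    exact ⟨fun h => ⟨(LeaningForest.overOp_mono hp.1 hp.2).trans h, h⟩, fun h => h.2⟩
  have h2 : NaturalAlgebra.F K f₁ * NaturalAlgebra.F K f₂ = ∑ p ∈ Finset.Ici f₁ ×ˢ Finset.Ici f₂,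
      (IncidenceAlgebra.mu K f₁ p.1 * IncidenceAlgebra.mu K f₂ p.2) •
        NaturalAlgebra.E K (p.1.overOp p.2) := by
    rw [NaturalAlgebra.F, NaturalAlgebra.F, Finset.sum_mul_sum, ← Finset.sum_product']
    refine Finset.sum_congr rfl fun p _ => ?_
    rw [smul_mul_smul_comm, NaturalAlgebra.E_mul_E]
  rw [h2, Finset.sum_congr rfl fun p hp => by rw [h1 p hp, Finset.smul_sum], Finset.sum_comm]
  have h3 : Finset.Icc (f₁.overOp f₂) (f₁.underOp f₂) =
      (Finset.Ici (f₁.overOp f₂)).filter fun f => f ≤ f₁.underOp f₂ := by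
    ext f
    simp
  rw [h3, Finset.sum_filter]
  refine Finset.sum_congr rfl fun f hf => ?_
  obtain ⟨g₁, g₂, hle, heq⟩ := LeaningForest.exists_overOp_le_iff (Finset.mem_Ici.1 hf)
  have h4 : (Finset.Ici f₁ ×ˢ Finset.Ici f₂).filter (fun p => p.1.overOp p.2 ≤ f) =
      Finset.Icc f₁ g₁ ×ˢ Finset.Icc f₂ g₂ := by
    ext p
    simp only [Finset.mem_filter, Finset.mem_product, Finset.mem_Ici, Finset.mem_Icc]
    constructor
    · rintro ⟨⟨h5, h6⟩, h7⟩
      have h8 := (hle _ _ h5 h6).1 h7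
      exact ⟨⟨h5, h8.1⟩, h6, h8.2⟩
    · rintro ⟨⟨h5, h6⟩, h7, h8⟩
      exact ⟨⟨h5, h7⟩, (hle _ _ h5 h7).2 ⟨h6, h8⟩⟩
  simp only [smul_ite, smul_zero]
  -- The pairs form a product of intervals, so the coefficient of `F f` factors into two Möbius
  -- sums, which are Kronecker deltas.
  rw [← Finset.sum_filter, h4, ← Finset.sum_smul, Finset.sum_product, ← Finset.sum_mul_sum,
    IncidenceAlgebra.sum_Icc_mu_right, IncidenceAlgebra.sum_Icc_mu_right, if_congr heq rfl rfl]
  by_cases h5 : f₁ = g₁ <;> by_cases h6 : f₂ = g₂ <;> simp [h5, h6]
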